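/- Let $n\ge 1$, $\kappa>1$, and write points of $\mathbb R^{n+1}$ as $X=(x,x_{n+1})$. For $X,Y\in\mathbb R^{n+1}$ put $c(X,Y)=\kappa(y_{n+1}-x_{n+1})-|X-Y|$, and for $b>0$ $$\phi_{Y,b}(x)=y_{n+1}-\frac{\kappa b}{\kappa^2-1}-\sqrt{\frac{b^2}{(\kappa^2-1)^2}+\frac{|x-y|^2}{\kappa^2-1}},\qquad \phi(x,Y,X_0)=\phi_{Y,c(X_0,Y)}(x).$$ For $v\in\mathbb R^n$ with $|v|^2\le 1/(\kappa^2-1)$ let $Q(v)=\dfrac{\kappa-\sqrt{1-(\kappa^2-1)|v|^2}}{1+|v|^2}$ and $\Lambda(v)=(Q(v)v,\kappa-Q(v))$, the direction of refraction. **Standing assumptions.** $\Omega\subset\mathbb R^n$ is a bounded open convex set, and $\Sigma\subset\mathbb R^n\times[\tau_1,\tau_1+\omega]$ is compact (for instance a compact hypersurface), where $\omega>0$ and $0<\tau_0<\tau_1$. Put $\Delta=\max_{Y\in\Sigma}\operatorname{diam}(\Omega\cup\{y\})$ and $\mathcal C_\Omega=\Omega\times[0,\tau_0]$. Assume $\tau_1>\Delta/\sqrt{\kappa^2-1}$;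 $\tau_1\ge\max\{\kappa\tau_0,\ \tau_0+\kappa\Delta/(\kappa-1)\}$; $e_{n+1}\cdot\frac{Y-X}{|Y-X|}\ge 1/\kappa$ for all $X\in\mathcal C_\Omega$, $Y\in\Sigma$; and for each $X\in\mathcal C_\Omega$ every $Y\in\Sigma$ has the form $Y=X+s_X(\Lambda)\Lambda$, where $\Lambda=\frac{Y-X}{|Y-X|}$ and $s_X$ is Lipschitz on the set of these directions. **Refractors.** A *parallel refractor* is a function $u:\Omega\to(0,\tau_0]$ such that for each $x_0\in\Omega$ there are $Y\in\Sigma$ and $0<b<\kappa y_{n+1}-\sqrt{y_{n+1}^2+\Delta^2}$ with $u\ge\phi_{Y,b}$ on $\Omega$ and equality at $x_0$. Its normal map is $F_u(x_0)=\{Y\in\Sigma:\ u(x)\ge\phi(x,Y,(x_0,u(x_0)))\ \forall x\in\Omega\}$, and $F_u(B)=\bigcup_{x\in B}F_u(x)$. **Regular targets.** For $Z=(z,z_{n+1})\in\mathcal C_\Omega$, $\bar Y,\hat Y\in\Sigma$ and $\lambda\in[0,1]$, let $v(\lambda)=(1-\lambda)D_x\phi(z,\bar Y,Z)+\lambda D_x\phi(z,\hat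 Y,Z)$; write $Y_Z(\lambda)$ for a point of $\Sigma$ of the form $Z+s\Lambda(v(\lambda))$, $s>0$ (there is at most one), and let $S_Z(\bar Y,\hat Y)$ be the set of all such points with $\lambda\in[\frac14,\frac34]$. The target is *regular from* $X^*\in\mathcal C_\Omega$ if there are a neighborhood $V$ of $X^*$ and $c_1,c_2>0$ such that for all $\bar Y,\hat Y\in\Sigma$, $Z\in V\cap\mathcal C_\Omega$, $Y\in S_Z(\bar Y,\hat Y)$ and $x\in\Omega$ with $|x-z|\le c_2$, $$\phi(x,Y,Z)\le\max\{\phi(x,\bar Y,Z),\phi(x,\hat Y,Z)\}-c_1|\bar Y-\hat Y|^2|x-z|^2 .$$ **Theorem.** Let $n\ge1$ and $q\ge1$ with $q(n-1)<n$ (that is, $1\le q<\frac{n}{n-1}$, with no upper bound if $n=1$), and let $$\alpha=\frac{\frac n{2q}-\frac{n-1}2}{1+\frac32(n-1)+\frac n{2q}}.$$ Then $0<\alpha<1$, and there is a positive function $C_1=C_1(C_0,\tilde C,M)$ of positive arguments, depending only on $n$ and $q$, with the following property. Suppose that the standing assumptions hold, that $\Sigma$ is regular from $X^*=(x^*,x^*_{n+1})\in\mathcal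 C_\Omega$, and let $U$ be a neighborhood of $X^*$ and $\mu_0>0$. Then there exist $\delta,M,C_2>0$ with $B_\delta(x^*)\subset\Omega$ such that the following holds for every parallel refractor $u$ with $u(x^*)=x^*_{n+1}$, every Radon measure $\sigma$ on $\Sigma$ and all $C_0,\tilde C>0$. Assume that 1. $\sigma\big[\mathcal N_\mu(S_Z(\bar Y,\hat Y))\cap\Sigma\big]\ge\tilde C\mu^{n-1}|\bar Y-\hat Y|$ for all $\bar Y,\hat Y\in\Sigma$, $Z\in U\cap\mathcal C_\Omega$ and $0<\mu<\mu_0$, where $\mathcal N_\mu$ denotes the open $\mu$-neighborhood; 2. $\sigma(F_u(B_\eta))\le C_0\eta^{n/q}$ for all balls $B_\eta\subset\subset\Omega$ of radius $\eta>0$. Then for all $\bar x,\hat x\in B_{\delta/2}(x^*)$, $\bar Y\in F_u(\bar x)$ and $\hat Y\in F_u(\hat x)$ with $$|\bar Y-\hat Y|\ge\max\Big\{1,\Big(\frac{2M}\delta\Big)^2,\Big(\frac{2M}{C_2}\Big)^2\Big\}|\bar x-\hat x|$$ one has $|\bar Y-\hat Y|\le C_1(C_0,\tilde C,M)\,|\bar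 x-\hat x|^\alpha$. Moreover $u\in C^{1,\alpha}(B_{\delta/2}(x^*))$. -/

import Mathlib

open Set Topology MeasureTheory

noncomputable section

/-- `ℝⁿ` with the Euclidean norm. -/
abbrev Base (n : ℕ) : Type := EuclideanSpace ℝ (Fin n)

/-- `ℝⁿ⁺¹ = ℝⁿ × ℝ` with the Euclidean norm. A point is `X = (x, xₙ₊₁)`, with `X.fst = x` and
`X.snd = xₙ₊₁`. -/
abbrev Space (n : ℕ) : Type := WithLp 2 (Base n × ℝ)

/-- The point `(x, h)` of `ℝⁿ⁺¹`. -/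
def pt {n : ℕ} (x : Base n) (h : ℝ) : Space n := WithLp.toLp 2 (x, h)

/-- `c(X, Y) = κ (yₙ₊₁ - xₙ₊₁) - |X - Y|`. -/
def cFun {n : ℕ} (κ : ℝ) (X Y : Space n) : ℝ := κ * (Y.snd - X.snd) - ‖X - Y‖

/-- `φ_{Y,b}`, whose graph is the lower sheet of the hyperboloid with upper focus `Y`,
eccentricity `κ` and parameter `b`. -/
def hyperboloid {n : ℕ} (κ : ℝ) (Y : Space n) (b : ℝ) (x : Base n) : ℝ :=
  Y.snd - κ * b / (κ ^ 2 - 1)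
    - Real.sqrt ((b / (κ ^ 2 - 1)) ^ 2 + ‖x - Y.fst‖ ^ 2 / (κ ^ 2 - 1))

/-- `φ(x, Y, X₀)`: the hyperboloid with upper focus `Y` that passes through `X₀`. -/
def phi {n : ℕ} (κ : ℝ) (x : Base n) (Y X₀ : Space n) : ℝ := hyperboloid κ Y (cFun κ X₀ Y) x

/-- `D_x φ(x₀, Y, X₀)`, where `X₀ = (x₀, ·)`. -/
def phiGrad {n : ℕ} (κ : ℝ) (Y X₀ : Space n) : Base n :=
  gradient (fun x => phi κ x Y X₀) X₀.fst

/-- The coefficient `Q(v)` of the refracted direction; it is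
`-δ / √(1 + |v|²)` with `δ = (-κ + √(1 - (κ² - 1)|v|²)) / √(1 + |v|²)`. -/
def snellQ {n : ℕ} (κ : ℝ) (v : Base n) : ℝ :=
  (κ - Real.sqrt (1 - (κ ^ 2 - 1) * ‖v‖ ^ 2)) / (1 + ‖v‖ ^ 2)

/-- Snell's law: `Λ(v) = (Q(v) v, κ - Q(v))` is the direction into which a vertical ray is
refracted by a hyperplane with upper normal `(-v, 1)`. -/
def refractedDir {n : ℕ} (κ : ℝ) (v : Base n) : Space n :=
  pt (snellQ κ v • v) (κ - snellQ κ v)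

/-- `Δ = sup_{Y ∈ T} diam (Ω ∪ {y})`. -/
def bigDelta {n : ℕ} (Ω : Set (Base n)) (T : Set (Space n)) : ℝ :=
  sSup ((fun Y : Space n => Metric.diam (Ω ∪ {Y.fst})) '' T)

/-- The cylinder `C_Ω = Ω × [0, τ₀]`. -/
def sourceCylinder {n : ℕ} (Ω : Set (Base n)) (τ₀ : ℝ) : Set (Space n) :=
  {X | X.fst ∈ Ω ∧ X.snd ∈ Icc 0 τ₀}

/-- The unit vector from `X` to `Y`. -/
def dirTo {n : ℕ} (X Y : Space n) : Space n := ‖Y - X‖⁻¹ • (Y - X)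

/-- The standing assumptions on the index ratio `κ = n₁ / n₂`, the source `Ω`, the target `T` and
the constants `τ₀, τ₁, ω`. -/
structure Configuration {n : ℕ} (κ : ℝ) (Ω : Set (Base n)) (T : Set (Space n))
    (τ₀ τ₁ ω : ℝ) : Prop where
  one_lt_kappa : 1 < κ
  source_open : IsOpen Ω
  source_bounded : Bornology.IsBounded Ω
  source_convex : Convex ℝ Ω
  target_compact : IsCompact T
  omega_pos : 0 < ω
  /-- The target lies in the slab `ℝⁿ × [τ₁, τ₁ + ω]`. -/
  target_slab : ∀ Y ∈ T, Y.snd ∈ Icc τ₁ (τ₁ + ω)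
  tau_zero_pos : 0 < τ₀
  tau_zero_lt : τ₀ < τ₁
  tau_one_gt : bigDelta Ω T / Real.sqrt (κ ^ 2 - 1) < τ₁
  /-- The compatibility condition. -/
  compatible : max (κ * τ₀) (τ₀ + κ * bigDelta Ω T / (κ - 1)) ≤ τ₁
  /-- No total internal reflection: `eₙ₊₁ · (Y - X)/|Y - X| ≥ n₂ / n₁`. -/
  no_total_reflection : ∀ X ∈ sourceCylinder Ω τ₀, ∀ Y ∈ T, 1 / κ ≤ (dirTo X Y).snd
  /-- From each `X` in the cylinder the target is a radial graph `Y = X + s_X(Λ) Λ`, `|Λ| = 1`,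
  with `s_X` Lipschitz on the set of directions in which the target is seen from `X`. -/
  radial_graph : ∀ X ∈ sourceCylinder Ω τ₀, ∃ s : Space n → ℝ, ∃ K : NNReal,
    LipschitzOnWith K s (dirTo X '' T) ∧ ∀ Y ∈ T, Y = X + s (dirTo X Y) • dirTo X Y

/-- `u : Ω → (0, ∞)` is a parallel refractor from `Ω` to `T`: at each point of its graph it is
supported from below by a hyperboloid with upper focus in `T` and admissible parameter `b`. -/
def IsRefractor {n : ℕ} (κ : ℝ) (Ω : Set (Base n)) (T : Set (Space n)) (u : Base n → ℝ) : Prop :=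
  (∀ x ∈ Ω, 0 < u x) ∧
  ∀ x₀ ∈ Ω, ∃ Y ∈ T, ∃ b : ℝ, 0 < b ∧
    b < κ * Y.snd - Real.sqrt (Y.snd ^ 2 + bigDelta Ω T ^ 2) ∧
    (∀ x ∈ Ω, hyperboloid κ Y b x ≤ u x) ∧ u x₀ = hyperboloid κ Y b x₀

/-- The refractor-normal map `F_u(x₀) = {Y ∈ T : u(x) ≥ φ(x, Y, (x₀, u(x₀))) for all x ∈ Ω}`. -/
def normalMap {n : ℕ} (κ : ℝ) (Ω : Set (Base n)) (T : Set (Space n)) (u : Base n → ℝ)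
    (x₀ : Base n) : Set (Space n) :=
  {Y | Y ∈ T ∧ ∀ x ∈ Ω, phi κ x Y (pt x₀ (u x₀)) ≤ u x}

/-- `v(l) = (1 - l) D_x φ(x₀, Y₁, X₀) + l D_x φ(x₀, Y₂, X₀)`. -/
def slopeAt {n : ℕ} (κ : ℝ) (X₀ Y₁ Y₂ : Space n) (l : ℝ) : Base n :=
  (1 - l) • phiGrad κ Y₁ X₀ + l • phiGrad κ Y₂ X₀

/-- `Y` is a point `Y(l) = X₀ + s Λ(v(l))`, `s > 0`, of the refractor segment `[Y₁, Y₂]_{X₀}`. -/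
def IsSegmentPoint {n : ℕ} (κ : ℝ) (T : Set (Space n)) (X₀ Y₁ Y₂ : Space n) (l : ℝ)
    (Y : Space n) : Prop :=
  Y ∈ T ∧ ∃ s : ℝ, 0 < s ∧ Y = X₀ + s • refractedDir κ (slopeAt κ X₀ Y₁ Y₂ l)

/-- `{Y(l) ∈ [Y₁, Y₂]_{X₀} : l ∈ [1/4, 3/4]}`. -/
def middleSegment {n : ℕ} (κ : ℝ) (T : Set (Space n)) (X₀ Y₁ Y₂ : Space n) : Set (Space n) :=
  {Y | ∃ l ∈ Icc (1 / 4 : ℝ) (3 / 4), IsSegmentPoint κ T X₀ Y₁ Y₂ l Y}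

/-- The target `T` is regular from `X₀`. -/
def RegularFrom {n : ℕ} (κ : ℝ) (Ω : Set (Base n)) (T : Set (Space n)) (τ₀ : ℝ)
    (X₀ : Space n) : Prop :=
  ∃ U ∈ 𝓝 X₀, ∃ C₁ > 0, ∃ C₂ > 0, ∀ Y₁ ∈ T, ∀ Y₂ ∈ T, ∀ Z ∈ U ∩ sourceCylinder Ω τ₀,
    ∀ x ∈ Ω, ‖x - Z.fst‖ ≤ C₂ → ∀ Y ∈ middleSegment κ T Z Y₁ Y₂,
      phi κ x Y Z ≤ max (phi κ x Y₁ Z) (phi κ x Y₂ Z) - C₁ * ‖Y₁ - Y₂‖ ^ 2 * ‖x - Z.fst‖ ^ 2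

/-- The local lower bound for `σ` on `μ`-neighborhoods of the middle parts of refractor segments,
seen from the points of the cylinder in `U`, for all `0 < μ < μ₀`, with constant `Ct`. -/
def LocalLowerBound {n : ℕ} (κ : ℝ) (Ω : Set (Base n)) (T : Set (Space n)) (τ₀ : ℝ)
    (U : Set (Space n)) (μ₀ Ct : ℝ) (σ : Measure (Space n)) : Prop :=
  ∀ Y₁ ∈ T, ∀ Y₂ ∈ T, ∀ Z ∈ U ∩ sourceCylinder Ω τ₀, ∀ μ : ℝ, 0 < μ → μ < μ₀ →
    ENNReal.ofReal (Ct * μ ^ (n - 1) * ‖Y₁ - Y₂‖)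
      ≤ σ (Metric.thickening μ (middleSegment κ T Z Y₁ Y₂) ∩ T)

/-- `σ(F_u(B_η)) ≤ C₀ η^{n/q}` for all balls `B_η ⊂⊂ Ω`. -/
def GrowthBound {n : ℕ} (κ : ℝ) (Ω : Set (Base n)) (T : Set (Space n)) (u : Base n → ℝ)
    (q C₀ : ℝ) (σ : Measure (Space n)) : Prop :=
  ∀ (z : Base n) (η : ℝ), 0 < η → Metric.closedBall z η ⊆ Ω →
    σ (⋃ x ∈ Metric.ball z η, normalMap κ Ω T u x) ≤ ENNReal.ofReal (C₀ * η ^ ((n : ℝ) / q))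

/-- `u ∈ C^{1,α}(B)` for an open set `B`. -/
def IsC1Holder {n : ℕ} (α : ℝ) (u : Base n → ℝ) (B : Set (Base n)) : Prop :=
  ContDiffOn ℝ 1 u B ∧
    ∃ K : ℝ, ∀ x ∈ B, ∀ y ∈ B, ‖gradient u x - gradient u y‖ ≤ K * ‖x - y‖ ^ α

/-- The Hölder exponent. -/
def holderExponent (n : ℕ) (q : ℝ) : ℝ :=
  ((n : ℝ) / (2 * q) - ((n : ℝ) - 1) / 2)
    / (1 + 3 / 2 * ((n : ℝ) - 1) + (n : ℝ) / (2 * q))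

end

/-! Take contact points x₁, x₂ at distance d, with foci Y₁ ≠ Y₂ at distance s ≥ d. The two
supporting hyperboloids meet over the segment [x₁, x₂] at a point Z = (z, ·) on or below the graph
(`exists_common_point`), and the graph is at most C s d above Z (`refractor_sub_le`). Consider a
hyperboloid through Z with focus in the middle of the refractor segment. Regularity puts it below
the maximum of the other two, hence below u, by a margin A s² |x - z|². Where |x - z| ≥ η, this
margin absorbs a shift of the focus by μ ~ η s² and the lift of the hyperboloid from Z to the graph,
provided η² s ≥ M² d. The shifted hyperboloid then lies below u outside B_η(z), so after a change of
parameter it touches the graph over B_η(z) (`exists_mem_normalMap`). Hence F_u(B_η(z)) contains the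
μ-neighborhood of the middle segment in the target (`thickening_subset`), and the two measure bounds
give Ct μ^(n-1) s ≤ C₀ η^(n/q) (`exists_growth_inequality`). The smallest admissible scale, η = M
√(d/s), turns this into a power law between s and d, which is the stated exponent
(`le_holderConst_mul_rpow`).

Regularity is only local in x, while the comparison is needed on all of Ω. For n ≥ 2, the squared
roots S² are quadratic polynomials with a common leading part, so the local inequality forces a gap
between the numbers 1/(2S) of the three hyperboloids (`curvature_gap`), and this gap gives the
inequality everywhere (`regular_global`). For n = 1, two hyperboloids with different foci cross at
most once inside the cylinder (`hyperboloid_le_on_segment`), so a comparison at distance η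
propagates outward.

Finally, Hölder dependence of the foci makes the supporting slopes Hölder. Since the supports are
semiconvex, these slopes are the gradient of u (`isC1Holder`). -/

/-! ### Calculus of a single hyperboloid: concavity, semiconvexity, dependence on the parameters. -/

section Hyperboloid

variable {n : ℕ} {κ : ℝ}

/-- The square root in the definition of the hyperboloid. -/
noncomputable def hypRoot (κ : ℝ) (Y : Space n) (b : ℝ) (x : Base n) : ℝ :=
  Real.sqrt ((b / (κ ^ 2 - 1)) ^ 2 + ‖x - Y.fst‖ ^ 2 / (κ ^ 2 - 1))

/-- The gradient of the hyperboloid. -/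
noncomputable def hypSlope (κ : ℝ) (Y : Space n) (b : ℝ) (x : Base n) : Base n :=
  ((κ ^ 2 - 1) * hypRoot κ Y b x)⁻¹ • (Y.fst - x)

lemma hyperboloid_eq (Y : Space n) (b : ℝ) (x : Base n) :
    hyperboloid κ Y b x = Y.snd - κ * b / (κ ^ 2 - 1) - hypRoot κ Y b x := rfl

lemma kappa_sq_sub_one_pos (hκ : 1 < κ) : 0 < κ ^ 2 - 1 := by nlinarith

lemma hypRoot_sq (hκ : 1 < κ) (Y : Space n) (b : ℝ) (x : Base n) :
    hypRoot κ Y b x ^ 2 = (b / (κ ^ 2 - 1)) ^ 2 + ‖x - Y.fst‖ ^ 2 / (κ ^ 2 - 1) := by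
  have := kappa_sq_sub_one_pos hκ
  exact Real.sq_sqrt (by positivity)

lemma le_hypRoot (hκ : 1 < κ) (Y : Space n) (b : ℝ) (x : Base n) :
    b / (κ ^ 2 - 1) ≤ hypRoot κ Y b x := by
  have := kappa_sq_sub_one_pos hκ
  exact Real.le_sqrt_of_sq_le (by have : 0 ≤ ‖x - Y.fst‖ ^ 2 / (κ ^ 2 - 1) := by positivity
                                  linarith)

lemma hypRoot_pos (hκ : 1 < κ) (Y : Space n) {b : ℝ} (hb : 0 < b) (x : Base n) :
    0 < hypRoot κ Y b x :=
  (div_pos hb (kappa_sq_sub_one_pos hκ)).trans_le (le_hypRoot hκ Y b x)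

lemma norm_sub_le_sqrt_mul_hypRoot (hκ : 1 < κ) (Y : Space n) (b : ℝ) (x : Base n) :
    ‖x - Y.fst‖ ≤ Real.sqrt (κ ^ 2 - 1) * hypRoot κ Y b x := by
  have hk := kappa_sq_sub_one_pos hκ
  have h0 : 0 ≤ hypRoot κ Y b x := Real.sqrt_nonneg _
  refine le_of_sq_le_sq ?_ (by positivity)
  rw [mul_pow, Real.sq_sqrt hk.le, hypRoot_sq hκ, mul_add, mul_div_cancel₀ _ hk.ne']
  have : 0 ≤ (κ ^ 2 - 1) * (b / (κ ^ 2 - 1)) ^ 2 := by positivity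
  linarith

lemma norm_sub_sq_eq_add (x x' y : Base n) :
    ‖x' - y‖ ^ 2 = ‖x - y‖ ^ 2 - 2 * inner ℝ (y - x) (x' - x) + ‖x' - x‖ ^ 2 := by
  have h : x' - y = (x' - x) - (y - x) := by abel
  rw [h, norm_sub_sq_real, real_inner_comm, norm_sub_rev y x]; ring

/-- The difference of the squared roots is a quadratic polynomial with leading part independent
of the hyperboloid. -/
lemma hypRoot_sq_sub (hκ : 1 < κ) (Y : Space n) {b : ℝ} (hb : 0 < b) (x x' : Base n) :
    hypRoot κ Y b x ^ 2 - hypRoot κ Y b x' ^ 2 =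
      2 * hypRoot κ Y b x * inner ℝ (hypSlope κ Y b x) (x' - x)
        - ‖x' - x‖ ^ 2 / (κ ^ 2 - 1) := by
  have hk := kappa_sq_sub_one_pos hκ
  have hS := hypRoot_pos hκ Y hb x
  rw [hypRoot_sq hκ Y b x', norm_sub_sq_eq_add x x' Y.fst]
  have h1 := hypRoot_sq hκ Y b x
  rw [hypSlope, real_inner_smul_left, mul_inv]
  field_simp
  field_simp at h1
  linear_combination h1

lemma mul_norm_hypSlope_sq (hκ : 1 < κ) (Y : Space n) {b : ℝ} (hb : 0 < b) (x : Base n) :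
    (κ ^ 2 - 1) * ‖hypSlope κ Y b x‖ ^ 2 =
      ‖x - Y.fst‖ ^ 2 / (b ^ 2 / (κ ^ 2 - 1) + ‖x - Y.fst‖ ^ 2) := by
  have hk := kappa_sq_sub_one_pos hκ
  have hS := hypRoot_pos hκ Y hb x
  have h1 : b ^ 2 / (κ ^ 2 - 1) + ‖x - Y.fst‖ ^ 2 = (κ ^ 2 - 1) * hypRoot κ Y b x ^ 2 := by
    rw [hypRoot_sq hκ]; field_simp
  rw [h1, hypSlope, norm_smul, norm_inv, Real.norm_eq_abs, abs_of_pos (by positivity),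
    norm_sub_rev Y.fst x]
  field_simp

/-- The right-hand side is less than 1: a lower bound on b keeps slopes over a bounded region
uniformly away from the asymptotic slope 1/√(κ² - 1). -/
lemma mul_norm_hypSlope_sq_le (hκ : 1 < κ) (Y : Space n) {b b₀ D : ℝ} (hb₀ : 0 < b₀)
    (hb : b₀ ≤ b) {x : Base n} (hx : ‖x - Y.fst‖ ≤ D) :
    (κ ^ 2 - 1) * ‖hypSlope κ Y b x‖ ^ 2 ≤ D ^ 2 / (b₀ ^ 2 / (κ ^ 2 - 1) + D ^ 2) := by
  have hk := kappa_sq_sub_one_pos hκ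
  have hb' : 0 < b := hb₀.trans_le hb
  rw [mul_norm_hypSlope_sq hκ Y hb' x]
  have h1 : ‖x - Y.fst‖ ^ 2 ≤ D ^ 2 := by gcongr
  have h2 : b₀ ^ 2 / (κ ^ 2 - 1) ≤ b ^ 2 / (κ ^ 2 - 1) := by gcongr
  have h3 : 0 < b₀ ^ 2 / (κ ^ 2 - 1) := by positivity
  have h4 : 0 ≤ ‖x - Y.fst‖ ^ 2 := by positivity
  rw [div_le_div_iff₀ (by linarith) (by linarith)]
  nlinarith [mul_le_mul h1 h2 h3.le (by positivity)]

lemma norm_hypSlope_le (hκ : 1 < κ) (Y : Space n) {b : ℝ} (hb : 0 < b) (x : Base n) :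
    ‖hypSlope κ Y b x‖ ≤ (Real.sqrt (κ ^ 2 - 1))⁻¹ := by
  have hk := kappa_sq_sub_one_pos hκ
  have h := mul_norm_hypSlope_sq_le hκ Y hb le_rfl (le_refl ‖x - Y.fst‖)
  have h1 : ‖x - Y.fst‖ ^ 2 / (b ^ 2 / (κ ^ 2 - 1) + ‖x - Y.fst‖ ^ 2) ≤ 1 :=
    div_le_one_of_le₀ (by have : 0 ≤ b ^ 2 / (κ ^ 2 - 1) := by positivity
                          linarith) (by positivity)
  refine le_of_sq_le_sq ?_ (by positivity)
  rw [inv_pow, Real.sq_sqrt hk.le, ← one_div, le_div_iff₀ hk]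
  linarith

/-- The hyperboloid lies below its tangent planes. -/
lemma hyperboloid_le_tangent (hκ : 1 < κ) (Y : Space n) {b : ℝ} (hb : 0 < b) (x x' : Base n) :
    hyperboloid κ Y b x' ≤ hyperboloid κ Y b x + inner ℝ (hypSlope κ Y b x) (x' - x) := by
  have hk := kappa_sq_sub_one_pos hκ
  have hS := hypRoot_pos hκ Y hb x
  have hS' := hypRoot_pos hκ Y hb x'
  have h := hypRoot_sq_sub hκ Y hb x x'
  rw [hyperboloid_eq, hyperboloid_eq]
  set p := inner ℝ (hypSlope κ Y b x) (x' - x) with hp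
  have hq : (κ ^ 2 - 1) * p ^ 2 ≤ ‖x' - x‖ ^ 2 := by
    have h1 : |p| ≤ (Real.sqrt (κ ^ 2 - 1))⁻¹ * ‖x' - x‖ :=
      (abs_real_inner_le_norm _ _).trans (by gcongr; exact norm_hypSlope_le hκ Y hb x)
    have h2 : p ^ 2 ≤ ((Real.sqrt (κ ^ 2 - 1))⁻¹ * ‖x' - x‖) ^ 2 := by
      rw [← sq_abs]; gcongr
    rw [mul_pow, inv_pow, Real.sq_sqrt hk.le] at h2
    calc _ ≤ (κ ^ 2 - 1) * ((κ ^ 2 - 1)⁻¹ * ‖x' - x‖ ^ 2) := by gcongr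
      _ = _ := by field_simp
  have hq' : p ^ 2 ≤ ‖x' - x‖ ^ 2 / (κ ^ 2 - 1) := by rw [le_div_iff₀ hk]; linarith
  -- Expanding (S - p)² and using p² ≤ |x' - x|²/(κ² - 1), the identity `h` gives (S - p)² ≤ S'².
  have : hypRoot κ Y b x - p ≤ hypRoot κ Y b x' := by
    refine le_of_sq_le_sq ?_ hS'.le
    nlinarith
  linarith

/-- The hyperboloid is semiconvex. -/
lemma tangent_sub_le_hyperboloid (hκ : 1 < κ) (Y : Space n) {b : ℝ} (hb : 0 < b)
    (x x' : Base n) :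
    hyperboloid κ Y b x + inner ℝ (hypSlope κ Y b x) (x' - x) - (2 * b)⁻¹ * ‖x' - x‖ ^ 2
      ≤ hyperboloid κ Y b x' := by
  have hk := kappa_sq_sub_one_pos hκ
  have hS := hypRoot_pos hκ Y hb x
  have hS' := hypRoot_pos hκ Y hb x'
  have h := hypRoot_sq_sub hκ Y hb x x'
  have hSb := le_hypRoot hκ Y b x
  rw [hyperboloid_eq, hyperboloid_eq]
  set p := inner ℝ (hypSlope κ Y b x) (x' - x) with hp
  set S := hypRoot κ Y b x
  set S' := hypRoot κ Y b x'
  -- This is 2S(S' - S) ≤ S'² - S² combined with `h`. The remainder is then estimated by (κ² - 1) S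
  -- ≥ b.
  have h1 : S' - S ≤ -p + ‖x' - x‖ ^ 2 / (κ ^ 2 - 1) / (2 * S) := by
    rw [← sub_le_iff_le_add', le_div_iff₀ (by positivity)]
    nlinarith [sq_nonneg (S - S')]
  have h2 : ‖x' - x‖ ^ 2 / (κ ^ 2 - 1) / (2 * S) ≤ (2 * b)⁻¹ * ‖x' - x‖ ^ 2 := by
    rw [div_div, div_eq_inv_mul]
    rw [div_le_iff₀ hk] at hSb
    have : 2 * b ≤ (κ ^ 2 - 1) * (2 * S) := by linarith
    exact mul_le_mul_of_nonneg_right (inv_anti₀ (by positivity) this) (by positivity)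
  linarith

/-- Serves both the hyperboloids (β = 2) and the refractor itself (β = 1 + α). -/
lemma hasGradientAt_of_abs_sub_le {f : Base n → ℝ} {v x : Base n} {K β : ℝ} (hβ : 1 < β)
    (h : ∀ᶠ x' in 𝓝 x, |f x' - f x - inner ℝ v (x' - x)| ≤ K * ‖x' - x‖ ^ β) :
    HasGradientAt f v x := by
  rw [hasGradientAt_iff_isLittleO]
  have h1 : (fun x' => f x' - f x - inner ℝ v (x' - x)) =O[𝓝 x] fun x' => ‖x' - x‖ ^ β :=
    Asymptotics.IsBigO.of_bound K (by
      filter_upwards [h] with x' hx'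
      rw [Real.norm_eq_abs, Real.norm_eq_abs, abs_of_nonneg (Real.rpow_nonneg (norm_nonneg _) _)]
      exact hx')
  refine h1.trans_isLittleO ?_
  have h2 : (fun x' : Base n => ‖x' - x‖ ^ β) = fun x' => ‖x' - x‖ ^ (β - 1) * ‖x' - x‖ := by
    funext x'
    rcases (norm_nonneg (x' - x)).eq_or_lt with h0 | h0
    · rw [← h0, Real.zero_rpow (by linarith)]; simp
    · rw [Real.rpow_sub_one h0.ne']; field_simp
  rw [h2]
  have h3 : Filter.Tendsto (fun x' : Base n => ‖x' - x‖ ^ (β - 1)) (𝓝 x) (𝓝 0) := by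
    have : Continuous fun x' : Base n => ‖x' - x‖ ^ (β - 1) :=
      (continuous_id.sub continuous_const).norm.rpow_const fun _ => Or.inr (by linarith)
    have h4 := this.tendsto x
    simpa [Real.zero_rpow (by linarith : β - 1 ≠ 0)] using h4
  have h5 := (Asymptotics.isLittleO_one_iff ℝ).2 h3
  have h6 := h5.mul_isBigO (Asymptotics.isBigO_refl (fun x' : Base n => ‖x' - x‖) (𝓝 x))
  simp only [one_mul] at h6
  exact (Asymptotics.isLittleO_norm_right (g' := fun x' : Base n => x' - x)).1 h6

lemma hasGradientAt_hyperboloid (hκ : 1 < κ) (Y : Space n) {b : ℝ} (hb : 0 < b) (x : Base n) :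
    HasGradientAt (hyperboloid κ Y b) (hypSlope κ Y b x) x := by
  refine hasGradientAt_of_abs_sub_le (K := (2 * b)⁻¹) (β := 2) (by norm_num)
    (Filter.Eventually.of_forall fun x' => ?_)
  rw [Real.rpow_two, abs_le]
  have h1 := hyperboloid_le_tangent hκ Y hb x x'
  have h2 := tangent_sub_le_hyperboloid hκ Y hb x x'
  have : 0 ≤ (2 * b)⁻¹ * ‖x' - x‖ ^ 2 := by positivity
  constructor <;> linarith

/-- By concavity the slopes at the two end points alone control the increment. -/
lemma abs_hyperboloid_sub_le_of_slope (hκ : 1 < κ) (Y : Space n) {b : ℝ} (hb : 0 < b) {K : ℝ}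
    {x x' : Base n} (hx : ‖hypSlope κ Y b x‖ ≤ K) (hx' : ‖hypSlope κ Y b x'‖ ≤ K) :
    |hyperboloid κ Y b x' - hyperboloid κ Y b x| ≤ K * ‖x' - x‖ := by
  have h1 := hyperboloid_le_tangent hκ Y hb x x'
  have h2 := hyperboloid_le_tangent hκ Y hb x' x
  have h3 := (real_inner_le_norm (hypSlope κ Y b x) (x' - x)).trans
    (mul_le_mul_of_nonneg_right hx (norm_nonneg _))
  have h4 := (real_inner_le_norm (hypSlope κ Y b x') (x - x')).trans
    (mul_le_mul_of_nonneg_right hx' (norm_nonneg _))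
  rw [norm_sub_rev x x'] at h4
  rw [abs_le]; constructor <;> linarith

lemma abs_hyperboloid_sub_le (hκ : 1 < κ) (Y : Space n) {b : ℝ} (hb : 0 < b) (x x' : Base n) :
    |hyperboloid κ Y b x' - hyperboloid κ Y b x| ≤ (Real.sqrt (κ ^ 2 - 1))⁻¹ * ‖x' - x‖ :=
  abs_hyperboloid_sub_le_of_slope hκ Y hb (norm_hypSlope_le hκ Y hb x) (norm_hypSlope_le hκ Y hb x')

lemma sqrt_sq_add_sq_sub_le (p q r s : ℝ) :
    Real.sqrt (p ^ 2 + q ^ 2) - Real.sqrt (r ^ 2 + s ^ 2) ≤ |p - r| + |q - s| := by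
  rw [sub_le_iff_le_add]
  refine Real.sqrt_le_iff.2 ⟨by positivity, ?_⟩
  have h1 : r ^ 2 + s ^ 2 = Real.sqrt (r ^ 2 + s ^ 2) ^ 2 := (Real.sq_sqrt (by positivity)).symm
  have hr : |r| ≤ Real.sqrt (r ^ 2 + s ^ 2) := Real.abs_le_sqrt (by nlinarith [sq_nonneg s])
  have hs : |s| ≤ Real.sqrt (r ^ 2 + s ^ 2) := Real.abs_le_sqrt (by nlinarith [sq_nonneg r])
  set w := Real.sqrt (r ^ 2 + s ^ 2)
  have e1 : r * (p - r) ≤ w * |p - r| := (le_abs_self _).trans (by rw [abs_mul]; gcongr)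
  have e2 : s * (q - s) ≤ w * |q - s| := (le_abs_self _).trans (by rw [abs_mul]; gcongr)
  nlinarith [sq_abs (p - r), sq_abs (q - s), mul_nonneg (abs_nonneg (p - r)) (abs_nonneg (q - s))]

lemma abs_hypRoot_sub_le (hκ : 1 < κ) (Y Y' : Space n) (b b' : ℝ) (x x' : Base n) :
    |hypRoot κ Y b x - hypRoot κ Y' b' x'| ≤ |b - b'| / (κ ^ 2 - 1)
      + ‖(Y.fst - x) - (Y'.fst - x')‖ / Real.sqrt (κ ^ 2 - 1) := by
  have hk := kappa_sq_sub_one_pos hκ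
  have hs : 0 < Real.sqrt (κ ^ 2 - 1) := Real.sqrt_pos.2 hk
  have key : ∀ (Y Y' : Space n) (b b' : ℝ) (x x' : Base n),
      hypRoot κ Y b x - hypRoot κ Y' b' x' ≤ |b - b'| / (κ ^ 2 - 1)
      + ‖(Y.fst - x) - (Y'.fst - x')‖ / Real.sqrt (κ ^ 2 - 1) := by
    intro Y Y' b b' x x'
    have h := sqrt_sq_add_sq_sub_le (b / (κ ^ 2 - 1)) (‖x - Y.fst‖ / Real.sqrt (κ ^ 2 - 1))
      (b' / (κ ^ 2 - 1)) (‖x' - Y'.fst‖ / Real.sqrt (κ ^ 2 - 1))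
    rw [div_pow ‖x - Y.fst‖, div_pow ‖x' - Y'.fst‖, Real.sq_sqrt hk.le] at h
    refine h.trans (add_le_add ?_ ?_)
    · rw [← sub_div, abs_div, abs_of_pos hk]
    · rw [← sub_div, abs_div, abs_of_pos hs]
      gcongr
      rw [norm_sub_rev x, norm_sub_rev x']
      exact abs_norm_sub_norm_le _ _
  rw [abs_le]
  constructor
  · have := key Y' Y b' b x' x
    rw [abs_sub_comm, norm_sub_rev] at this
    linarith
  · exact key Y Y' b b' x x'

lemma abs_hyperboloid_sub_param_le (hκ : 1 < κ) (Y : Space n) (b b' : ℝ) (x : Base n) :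
    |hyperboloid κ Y b x - hyperboloid κ Y b' x| ≤ (κ + 1) / (κ ^ 2 - 1) * |b - b'| := by
  have hk := kappa_sq_sub_one_pos hκ
  have h := abs_hypRoot_sub_le hκ Y Y b b' x x
  rw [sub_self, norm_zero, zero_div, add_zero] at h
  have e : hyperboloid κ Y b x - hyperboloid κ Y b' x =
      -(κ / (κ ^ 2 - 1) * (b - b')) - (hypRoot κ Y b x - hypRoot κ Y b' x) := by
    rw [hyperboloid_eq, hyperboloid_eq]; ring
  rw [e]
  refine (abs_sub _ _).trans ?_
  rw [abs_neg, abs_mul, abs_of_pos (by positivity : 0 < κ / (κ ^ 2 - 1))]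
  calc _ ≤ κ / (κ ^ 2 - 1) * |b - b'| + |b - b'| / (κ ^ 2 - 1) := by gcongr
    _ = _ := by ring

/-- The slope solves (κ² - 1) S v = y - x. Subtracting two such equations leaves the difference of
the right-hand sides and (S - S') v', where v' is bounded; the division uses (κ² - 1) S ≥ b₀. -/
lemma norm_hypSlope_sub_le (hκ : 1 < κ) (Y Y' : Space n) {b b' b₀ : ℝ} (hb₀ : 0 < b₀)
    (hb : b₀ ≤ b) (hb' : b₀ ≤ b') (x x' : Base n) :
    ‖hypSlope κ Y b x - hypSlope κ Y' b' x'‖ ≤ b₀⁻¹ * (2 + (Real.sqrt (κ ^ 2 - 1))⁻¹) *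
      (‖(Y.fst - x) - (Y'.fst - x')‖ + |b - b'|) := by
  have hk := kappa_sq_sub_one_pos hκ
  have hs : 0 < Real.sqrt (κ ^ 2 - 1) := Real.sqrt_pos.2 hk
  have hss := Real.sq_sqrt hk.le
  have hS := hypRoot_pos hκ Y (hb₀.trans_le hb) x
  have hS' := hypRoot_pos hκ Y' (hb₀.trans_le hb') x'
  have hSb := le_hypRoot hκ Y b x
  have hsl := norm_hypSlope_le hκ Y' (hb₀.trans_le hb') x'
  have hr := abs_hypRoot_sub_le hκ Y Y' b b' x x'
  rw [div_le_iff₀ hk] at hSb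
  set S := hypRoot κ Y b x
  set S' := hypRoot κ Y' b' x'
  set w := (Y.fst - x) - (Y'.fst - x') with hw
  set s := Real.sqrt (κ ^ 2 - 1)
  have e : hypSlope κ Y b x - hypSlope κ Y' b' x' =
      ((κ ^ 2 - 1) * S)⁻¹ • (w - ((κ ^ 2 - 1) * (S - S')) • hypSlope κ Y' b' x') := by
    have e1 : Y'.fst - x' = ((κ ^ 2 - 1) * S') • hypSlope κ Y' b' x' := by
      rw [hypSlope, smul_smul, mul_inv_cancel₀ (by positivity), one_smul]
    have e2 : hypSlope κ Y b x = ((κ ^ 2 - 1) * S)⁻¹ • (w + (Y'.fst - x')) := by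
      rw [hw, sub_add_cancel]; rfl
    rw [e2, e1]
    clear_value w
    match_scalars <;> field_simp
    ring
  have hA : 0 ≤ |b - b'| := abs_nonneg _
  have hW : 0 ≤ ‖w‖ := norm_nonneg _
  have h1 : ‖w - ((κ ^ 2 - 1) * (S - S')) • hypSlope κ Y' b' x'‖ ≤
      ‖w‖ + (κ ^ 2 - 1) * (|b - b'| / (κ ^ 2 - 1) + ‖w‖ / s) * s⁻¹ := by
    refine (norm_sub_le _ _).trans ?_
    rw [norm_smul, Real.norm_eq_abs, abs_mul, abs_of_pos hk]
    gcongr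
  have h2 : ‖w‖ + (κ ^ 2 - 1) * (|b - b'| / (κ ^ 2 - 1) + ‖w‖ / s) * s⁻¹ =
      2 * ‖w‖ + s⁻¹ * |b - b'| := by
    rw [← hss]; field_simp; ring
  rw [e, norm_smul, norm_inv, Real.norm_eq_abs, abs_of_pos (by positivity)]
  calc ((κ ^ 2 - 1) * S)⁻¹ * _ ≤ b₀⁻¹ * (2 * ‖w‖ + s⁻¹ * |b - b'|) := by
        gcongr
        · linarith
        · linarith
    _ ≤ b₀⁻¹ * ((2 + s⁻¹) * (‖w‖ + |b - b'|)) := by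
        gcongr
        have : 0 ≤ s⁻¹ * ‖w‖ := by positivity
        nlinarith
    _ = _ := by ring

end Hyperboloid

/-! ### Hyperboloids through a given point, and Snell's law. -/

section Focus

variable {n : ℕ} {κ : ℝ}

lemma pt_fst (x : Base n) (h : ℝ) : (pt x h).fst = x := rfl

lemma pt_snd (x : Base n) (h : ℝ) : (pt x h).snd = h := rfl

lemma space_norm_sq (X : Space n) : ‖X‖ ^ 2 = ‖X.fst‖ ^ 2 + X.snd ^ 2 := by
  rw [WithLp.prod_norm_sq_eq_of_L2, Real.norm_eq_abs, sq_abs]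

lemma norm_sub_sq_fst_snd (X Y : Space n) :
    ‖X - Y‖ ^ 2 = ‖X.fst - Y.fst‖ ^ 2 + (Y.snd - X.snd) ^ 2 := by
  rw [space_norm_sq, WithLp.sub_fst, WithLp.sub_snd]; ring

lemma space_norm_fst_le (X : Space n) : ‖X.fst‖ ≤ ‖X‖ :=
  le_of_sq_le_sq (by rw [space_norm_sq]; nlinarith [sq_nonneg X.snd]) (norm_nonneg _)

lemma abs_snd_le (X : Space n) : |X.snd| ≤ ‖X‖ :=
  le_of_sq_le_sq (by rw [space_norm_sq, sq_abs]; nlinarith [sq_nonneg ‖X.fst‖]) (norm_nonneg _)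

lemma norm_le_fst_add_snd (X : Space n) : ‖X‖ ≤ ‖X.fst‖ + |X.snd| :=
  le_of_sq_le_sq (by
    rw [space_norm_sq, ← sq_abs X.snd]
    nlinarith [mul_nonneg (norm_nonneg X.fst) (abs_nonneg X.snd)]) (by positivity)

lemma abs_cFun_sub_le (hκ : 1 < κ) (X X' Y Y' : Space n) :
    |cFun κ X Y - cFun κ X' Y'| ≤ (κ + 1) * (‖X - X'‖ + ‖Y - Y'‖) := by
  have h1 := abs_snd_le (X - X')
  have h2 := abs_snd_le (Y - Y')
  have h3 : |‖X - Y‖ - ‖X' - Y'‖| ≤ ‖X - X'‖ + ‖Y - Y'‖ := by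
    refine (abs_norm_sub_norm_le _ _).trans ?_
    have : X - Y - (X' - Y') = (X - X') - (Y - Y') := by abel
    rw [this]; exact norm_sub_le _ _
  rw [WithLp.sub_snd] at h1 h2
  rw [abs_le] at h1 h2 h3 ⊢
  unfold cFun
  constructor <;> nlinarith

lemma snd_lt_kappa_mul_norm_sub (hκ : 1 < κ) {X Y : Space n} (h : X.snd < Y.snd) :
    Y.snd - X.snd < κ * ‖X - Y‖ := by
  have h1 := abs_snd_le (Y - X)
  rw [WithLp.sub_snd, abs_of_pos (sub_pos.2 h), norm_sub_rev] at h1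
  nlinarith

lemma hypRoot_cFun (hκ : 1 < κ) (X Y : Space n) :
    hypRoot κ Y (cFun κ X Y) X.fst = (κ * ‖X - Y‖ - (Y.snd - X.snd)) / (κ ^ 2 - 1) := by
  have hk := kappa_sq_sub_one_pos hκ
  have h1 := abs_snd_le (Y - X)
  rw [WithLp.sub_snd, norm_sub_rev] at h1
  have h2 := (le_abs_self _).trans h1
  have h3 : ‖X.fst - Y.fst‖ ^ 2 = ‖X - Y‖ ^ 2 - (Y.snd - X.snd) ^ 2 := by
    rw [norm_sub_sq_fst_snd]; ring
  have h4 : ‖X - Y‖ ≤ κ * ‖X - Y‖ := by nlinarith [norm_nonneg (X - Y)]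
  rw [hypRoot, Real.sqrt_eq_iff_mul_self_eq (by positivity) (div_nonneg (by linarith) hk.le), h3,
    cFun]
  field_simp
  ring

/-- The hyperboloid with focus `Y` and parameter `c(X, Y)` passes through `X`. -/
lemma hyperboloid_cFun (hκ : 1 < κ) (X Y : Space n) :
    hyperboloid κ Y (cFun κ X Y) X.fst = X.snd := by
  have hk := kappa_sq_sub_one_pos hκ
  rw [hyperboloid_eq, hypRoot_cFun hκ, cFun]
  field_simp
  ring

lemma cFun_hyperboloid (hκ : 1 < κ) (Y : Space n) {b : ℝ} (hb : 0 ≤ b) (x : Base n) :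
    cFun κ (pt x (hyperboloid κ Y b x)) Y = b := by
  have hk := kappa_sq_sub_one_pos hκ
  have hS : 0 ≤ hypRoot κ Y b x := Real.sqrt_nonneg _
  have hS2 := hypRoot_sq hκ Y b x
  have h : ‖pt x (hyperboloid κ Y b x) - Y‖ = κ * (κ * b / (κ ^ 2 - 1) + hypRoot κ Y b x) - b := by
    refine (sq_eq_sq₀ (norm_nonneg _) ?_).1 ?_
    · have : b ≤ κ * (κ * b / (κ ^ 2 - 1)) := by
        rw [← mul_div_assoc, le_div_iff₀ hk]; nlinarith
      nlinarith
    · rw [norm_sub_sq_fst_snd, pt_fst, pt_snd, hyperboloid_eq]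
      have hR : ‖x - Y.fst‖ ^ 2 = (κ ^ 2 - 1) * hypRoot κ Y b x ^ 2 - b ^ 2 / (κ ^ 2 - 1) := by
        rw [hS2]; field_simp; ring
      rw [hR]
      field_simp
      ring
  rw [cFun, h, pt_snd, hyperboloid_eq]
  ring

lemma cFun_strictAnti (hκ : 1 < κ) (x : Base n) (Y : Space n) :
    StrictAnti fun h : ℝ => cFun κ (pt x h) Y := by
  intro h h' hh
  have h1 : ‖pt x h - Y‖ ≤ ‖pt x h' - Y‖ + (h' - h) := by
    have e : pt x h - Y = (pt x h' - Y) - (pt x h' - pt x h) := by abel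
    have e2 : ‖pt x h' - pt x h‖ ≤ h' - h := by
      refine (norm_le_fst_add_snd _).trans ?_
      rw [WithLp.sub_fst, WithLp.sub_snd, pt_fst, pt_fst, pt_snd, pt_snd, sub_self, norm_zero,
        zero_add, abs_of_pos (sub_pos.2 hh)]
    rw [e]; exact (norm_sub_le _ _).trans (by linarith)
  simp only [cFun, pt_snd]
  nlinarith

/-- Along a vertical line c(·, Y) is strictly decreasing. Comparing a hyperboloid with a graph is
thus the same as comparing parameters, and touching from below becomes maximizing c((x, u(x)), Y).
-/
lemma hyperboloid_le_iff (hκ : 1 < κ) (Y : Space n) {b : ℝ} (hb : 0 ≤ b) (x : Base n) (h : ℝ) :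
    hyperboloid κ Y b x ≤ h ↔ cFun κ (pt x h) Y ≤ b := by
  rw [← (cFun_strictAnti hκ x Y).le_iff_ge (a := h), cFun_hyperboloid hκ Y hb]

lemma phi_self (hκ : 1 < κ) (X Y : Space n) : phi κ X.fst Y X = X.snd := hyperboloid_cFun hκ X Y

/-- The hyperboloid is determined by its focus and any of its points. -/
lemma phi_pt_hyperboloid (hκ : 1 < κ) (Y : Space n) {b : ℝ} (hb : 0 ≤ b) (x x₀ : Base n) :
    phi κ x Y (pt x₀ (hyperboloid κ Y b x₀)) = hyperboloid κ Y b x := by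
  rw [phi, cFun_hyperboloid hκ Y hb]

lemma phiGrad_eq (hκ : 1 < κ) {X Y : Space n} (hc : 0 < cFun κ X Y) :
    phiGrad κ Y X = hypSlope κ Y (cFun κ X Y) X.fst :=
  (hasGradientAt_hyperboloid hκ Y hc X.fst).gradient

lemma hypSlope_cFun (hκ : 1 < κ) (X Y : Space n) :
    hypSlope κ Y (cFun κ X Y) X.fst =
      (κ * ‖X - Y‖ - (Y.snd - X.snd))⁻¹ • (Y.fst - X.fst) := by
  have hk := kappa_sq_sub_one_pos hκ
  rw [hypSlope, hypRoot_cFun hκ, mul_div_cancel₀ _ hk.ne']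

lemma snellQ_equation {v : Base n} (hv : (κ ^ 2 - 1) * ‖v‖ ^ 2 ≤ 1) :
    (1 + ‖v‖ ^ 2) * snellQ κ v ^ 2 - 2 * κ * snellQ κ v + (κ ^ 2 - 1) = 0 := by
  have h := Real.sq_sqrt (sub_nonneg.2 hv)
  have hp : 0 < 1 + ‖v‖ ^ 2 := by positivity
  rw [snellQ]
  generalize Real.sqrt (1 - (κ ^ 2 - 1) * ‖v‖ ^ 2) = r at h ⊢
  field_simp
  linear_combination h

lemma snellQ_pos (hκ : 1 < κ) (v : Base n) : 0 < snellQ κ v := by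
  have hk := kappa_sq_sub_one_pos hκ
  refine div_pos (sub_pos.2 ((Real.sqrt_le_one.2 ?_).trans_lt hκ)) (by positivity)
  have : 0 ≤ (κ ^ 2 - 1) * ‖v‖ ^ 2 := by positivity
  linarith

lemma norm_refractedDir {v : Base n} (hv : (κ ^ 2 - 1) * ‖v‖ ^ 2 ≤ 1) :
    ‖refractedDir κ v‖ = 1 := by
  have h := snellQ_equation hv
  rw [← sq_eq_sq₀ (norm_nonneg _) zero_le_one, space_norm_sq, refractedDir, pt_fst, pt_snd,
    norm_smul, mul_pow, Real.norm_eq_abs, sq_abs]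
  linear_combination h

/-- The hyperboloid through `X` with focus on the ray refracted by slope `v` has slope `v`. -/
lemma hypSlope_of_refractedDir (hκ : 1 < κ) {X Y : Space n} {v : Base n} {s : ℝ} (hs : 0 < s)
    (hv : (κ ^ 2 - 1) * ‖v‖ ^ 2 ≤ 1) (hY : Y = X + s • refractedDir κ v) :
    hypSlope κ Y (cFun κ X Y) X.fst = v := by
  have hd : Y - X = s • refractedDir κ v := by rw [hY]; abel
  have hn : ‖X - Y‖ = s := by
    rw [norm_sub_rev, hd, norm_smul, norm_refractedDir hv, Real.norm_eq_abs, abs_of_pos hs, mul_one]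
  have h1 : Y.fst - X.fst = (s * snellQ κ v) • v := by
    rw [← WithLp.sub_fst, hd, WithLp.smul_fst, refractedDir, pt_fst, smul_smul]
  have h2 : Y.snd - X.snd = s * (κ - snellQ κ v) := by
    rw [← WithLp.sub_snd, hd, WithLp.smul_snd, refractedDir, pt_snd, smul_eq_mul]
  have hQ := snellQ_pos hκ v
  rw [hypSlope_cFun hκ, hn, h1, h2, smul_smul]
  have : (κ * s - s * (κ - snellQ κ v))⁻¹ * (s * snellQ κ v) = 1 := by
    rw [show κ * s - s * (κ - snellQ κ v) = s * snellQ κ v by ring]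
    exact inv_mul_cancel₀ (by positivity)
  rw [this, one_smul]

/-- Eliminating N from two distinct roots gives Vieta's relation 1/p + 1/q = 2κ/(κ² - 1). The bounds
make each reciprocal at least κ/(κ² - 1), so both are equal to it. In the application these bounds
express the absence of total reflection. -/
lemma refraction_root_unique (hκ : 1 < κ) {N p q : ℝ} (hp : 0 < p) (hq : 0 < q)
    (hp' : κ * p ≤ κ ^ 2 - 1) (hq' : κ * q ≤ κ ^ 2 - 1)
    (h1 : N * p ^ 2 - 2 * κ * p + (κ ^ 2 - 1) = 0)
    (h2 : N * q ^ 2 - 2 * κ * q + (κ ^ 2 - 1) = 0) : p = q := by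
  have hk := kappa_sq_sub_one_pos hκ
  have h3 : (p - q) * ((κ ^ 2 - 1) * (p + q) - 2 * κ * p * q) = 0 := by
    linear_combination p ^ 2 * h2 - q ^ 2 * h1
  rcases mul_eq_zero.1 h3 with h | h
  · linarith
  · have h4 : p * (κ ^ 2 - 1 - κ * q) + q * (κ ^ 2 - 1 - κ * p) = 0 := by linear_combination h
    have h5 : 0 ≤ p * (κ ^ 2 - 1 - κ * q) := mul_nonneg hp.le (by linarith)
    have h6 : 0 ≤ q * (κ ^ 2 - 1 - κ * p) := mul_nonneg hq.le (by linarith)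
    have h7 : p * (κ ^ 2 - 1 - κ * q) = 0 := by linarith
    have h8 : q * (κ ^ 2 - 1 - κ * p) = 0 := by linarith
    have h9 := (mul_eq_zero.1 h7).resolve_left hp.ne'
    have h10 := (mul_eq_zero.1 h8).resolve_left hq.ne'
    exact mul_left_cancel₀ (by linarith : κ ≠ 0) (by linarith : κ * p = κ * q)

/-- The number κ - Λₙ₊₁ plays the role of Q(v), and |Λ| = 1 is the quadratic equation for it. This
recovers the direction from the slope. -/
lemma dirTo_fst_snd {X Y : Space n} (hXY : X.snd < Y.snd) {v : Base n}
    (hv : hypSlope κ Y (cFun κ X Y) X.fst = v) (hκ : 1 < κ) :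
    0 < κ - (dirTo X Y).snd ∧ (dirTo X Y).fst = (κ - (dirTo X Y).snd) • v ∧
      (1 + ‖v‖ ^ 2) * (κ - (dirTo X Y).snd) ^ 2 - 2 * κ * (κ - (dirTo X Y).snd)
        + (κ ^ 2 - 1) = 0 := by
  have hlt := snd_lt_kappa_mul_norm_sub hκ hXY
  have hpos : 0 < ‖Y - X‖ := by
    rw [norm_sub_rev]
    by_contra h
    have : ‖X - Y‖ = 0 := le_antisymm (not_lt.1 h) (norm_nonneg _)
    rw [this] at hlt; linarith
  have e1 : κ - (dirTo X Y).snd = ‖Y - X‖⁻¹ * (κ * ‖X - Y‖ - (Y.snd - X.snd)) := by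
    rw [dirTo, WithLp.smul_snd, WithLp.sub_snd, smul_eq_mul, norm_sub_rev X Y]
    field_simp
  have e2 : (dirTo X Y).fst = (κ - (dirTo X Y).snd) • v := by
    rw [← hv, hypSlope_cFun hκ, smul_smul, e1, dirTo, WithLp.smul_fst, WithLp.sub_fst, mul_assoc,
      mul_inv_cancel₀ (by linarith), mul_one]
  refine ⟨by rw [e1]; exact mul_pos (inv_pos.2 hpos) (by linarith), e2, ?_⟩
  have h3 : ‖dirTo X Y‖ ^ 2 = 1 := by
    rw [dirTo, norm_smul, norm_inv, norm_norm, inv_mul_cancel₀ hpos.ne', one_pow]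
  rw [space_norm_sq, e2, norm_smul, mul_pow, Real.norm_eq_abs, sq_abs] at h3
  linear_combination h3

end Focus

/-! ### Consequences of the standing assumptions. -/

section Config

variable {n : ℕ} {κ τ₀ τ₁ ω : ℝ} {Ω : Set (Base n)} {T : Set (Space n)}

lemma Configuration.norm_sub_le_bigDelta (hC : Configuration κ Ω T τ₀ τ₁ ω) {x : Base n}
    (hx : x ∈ Ω) {Y : Space n} (hY : Y ∈ T) : ‖x - Y.fst‖ ≤ bigDelta Ω T := by
  have hb : Bornology.IsBounded (Ω ∪ (WithLp.fst '' T)) :=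
    hC.source_bounded.union ((hC.target_compact.image (by fun_prop)).isBounded)
  have h1 : ‖x - Y.fst‖ ≤ Metric.diam (Ω ∪ {Y.fst}) := by
    rw [← dist_eq_norm]
    exact Metric.dist_le_diam_of_mem (hC.source_bounded.union Bornology.isBounded_singleton)
      (Or.inl hx) (Or.inr rfl)
  refine h1.trans (le_csSup ⟨Metric.diam (Ω ∪ (WithLp.fst '' T)), ?_⟩ ⟨Y, hY, rfl⟩)
  rintro _ ⟨Y', hY', rfl⟩
  refine Metric.diam_mono ?_ hb
  rintro z (hz | hz)
  · exact Or.inl hz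
  · exact Or.inr ⟨Y', hY', hz.symm⟩

lemma Configuration.snd_lt (hC : Configuration κ Ω T τ₀ τ₁ ω) {X Y : Space n}
    (hX : X ∈ sourceCylinder Ω τ₀) (hY : Y ∈ T) : X.snd < Y.snd :=
  hX.2.2.trans_lt (hC.tau_zero_lt.trans_le (hC.target_slab Y hY).1)

/-- From |X - Y| ≤ Δ + (yₙ₊₁ - xₙ₊₁) one gets c ≥ (κ - 1)(τ₁ - τ₀) - Δ, and the compatibility
condition bounds Δ by (κ - 1)(τ₁ - τ₀)/κ. -/
lemma Configuration.cFun_lower (hC : Configuration κ Ω T τ₀ τ₁ ω) {X Y : Space n}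
    (hX : X ∈ sourceCylinder Ω τ₀) (hY : Y ∈ T) :
    (κ - 1) ^ 2 / κ * (τ₁ - τ₀) ≤ cFun κ X Y := by
  have hκ := hC.one_lt_kappa
  have h1 := hC.norm_sub_le_bigDelta hX.1 hY
  have h2 := (le_max_right _ _).trans hC.compatible
  have h3 := hX.2.2
  have h4 := (hC.target_slab Y hY).1
  have h5 := norm_le_fst_add_snd (X - Y)
  rw [WithLp.sub_fst, WithLp.sub_snd, abs_sub_comm,
    abs_of_pos (sub_pos.2 (hC.snd_lt hX hY))] at h5
  have h6 : κ * bigDelta Ω T ≤ (κ - 1) * (τ₁ - τ₀) := by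
    have : κ * bigDelta Ω T / (κ - 1) ≤ τ₁ - τ₀ := by linarith
    rw [div_le_iff₀ (by linarith)] at this
    linarith
  have h7 : bigDelta Ω T ≤ (κ - 1) * (τ₁ - τ₀) / κ := by
    rw [le_div_iff₀ (by linarith)]; linarith
  have h8 : (κ - 1) ^ 2 / κ * (τ₁ - τ₀) = (κ - 1) * (τ₁ - τ₀) - (κ - 1) * (τ₁ - τ₀) / κ := by
    field_simp
  rw [h8, cFun]
  nlinarith

lemma Configuration.lower_pos (hC : Configuration κ Ω T τ₀ τ₁ ω) :
    0 < (κ - 1) ^ 2 / κ * (τ₁ - τ₀) := by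
  have hκ := hC.one_lt_kappa
  have := hC.tau_zero_lt
  have h1 : 0 < κ - 1 := by linarith
  have h2 : 0 < τ₁ - τ₀ := by linarith
  positivity

lemma Configuration.cFun_pos (hC : Configuration κ Ω T τ₀ τ₁ ω) {X Y : Space n}
    (hX : X ∈ sourceCylinder Ω τ₀) (hY : Y ∈ T) : 0 < cFun κ X Y :=
  hC.lower_pos.trans_le (hC.cFun_lower hX hY)

/-- From a point of the cylinder, the slope determines the target point. -/
lemma Configuration.slope_injective (hC : Configuration κ Ω T τ₀ τ₁ ω) {X Y Y' : Space n}
    (hX : X ∈ sourceCylinder Ω τ₀) (hY : Y ∈ T) (hY' : Y' ∈ T)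
    (h : hypSlope κ Y (cFun κ X Y) X.fst = hypSlope κ Y' (cFun κ X Y') X.fst) : Y = Y' := by
  have hκ := hC.one_lt_kappa
  obtain ⟨a1, a2, a3⟩ := dirTo_fst_snd (hC.snd_lt hX hY) h hκ
  obtain ⟨b1, b2, b3⟩ := dirTo_fst_snd (hC.snd_lt hX hY') rfl hκ
  have c1 := hC.no_total_reflection X hX Y hY
  have c2 := hC.no_total_reflection X hX Y' hY'
  rw [div_le_iff₀ (by linarith)] at c1 c2
  have e := refraction_root_unique hκ a1 b1 (by nlinarith) (by nlinarith) a3 b3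
  have hd : dirTo X Y = dirTo X Y' := by
    refine WithLp.ofLp_injective 2 (Prod.ext ?_ ?_)
    · change (dirTo X Y).fst = (dirTo X Y').fst
      rw [a2, b2, e]
    · change (dirTo X Y).snd = (dirTo X Y').snd
      linarith
  obtain ⟨s, K, -, hs⟩ := hC.radial_graph X hX
  rw [hs Y hY, hs Y' hY', hd]

lemma Configuration.phiGrad_eq (hC : Configuration κ Ω T τ₀ τ₁ ω) {X Y : Space n}
    (hX : X ∈ sourceCylinder Ω τ₀) (hY : Y ∈ T) :
    phiGrad κ Y X = hypSlope κ Y (cFun κ X Y) X.fst :=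
  _root_.phiGrad_eq hC.one_lt_kappa (hC.cFun_pos hX hY)

/-- The slope at `Z` of the hyperboloid with focus on a refractor segment is the convex
combination of the slopes at the end points. -/
lemma Configuration.slope_of_isSegmentPoint (hC : Configuration κ Ω T τ₀ τ₁ ω)
    {Z Y₁ Y₂ Y : Space n} (hZ : Z ∈ sourceCylinder Ω τ₀) (hY₁ : Y₁ ∈ T) (hY₂ : Y₂ ∈ T) {l : ℝ}
    (hl : l ∈ Icc (0 : ℝ) 1) (hY : IsSegmentPoint κ T Z Y₁ Y₂ l Y) :
    hypSlope κ Y (cFun κ Z Y) Z.fst = (1 - l) • hypSlope κ Y₁ (cFun κ Z Y₁) Z.fst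
      + l • hypSlope κ Y₂ (cFun κ Z Y₂) Z.fst := by
  have hκ := hC.one_lt_kappa
  have hk := kappa_sq_sub_one_pos hκ
  obtain ⟨-, s, hs, hYs⟩ := hY
  rw [← hC.phiGrad_eq hZ hY₁, ← hC.phiGrad_eq hZ hY₂]
  refine hypSlope_of_refractedDir hκ hs ?_ hYs
  have h1 := norm_hypSlope_le hκ Y₁ (hC.cFun_pos hZ hY₁) Z.fst
  have h2 := norm_hypSlope_le hκ Y₂ (hC.cFun_pos hZ hY₂) Z.fst
  rw [← hC.phiGrad_eq hZ hY₁] at h1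
  rw [← hC.phiGrad_eq hZ hY₂] at h2
  -- The slopes admissible in Snell's law form a closed ball, so convex combinations stay
  -- admissible.
  have h3 : ‖slopeAt κ Z Y₁ Y₂ l‖ ≤ (Real.sqrt (κ ^ 2 - 1))⁻¹ := by
    have : slopeAt κ Z Y₁ Y₂ l ∈ Metric.closedBall 0 (Real.sqrt (κ ^ 2 - 1))⁻¹ :=
      (convex_closedBall (0 : Base n) (Real.sqrt (κ ^ 2 - 1))⁻¹)
      (mem_closedBall_zero_iff.2 h1) (mem_closedBall_zero_iff.2 h2) (sub_nonneg.2 hl.2) hl.1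
      (sub_add_cancel 1 l)
    exact mem_closedBall_zero_iff.1 this
  calc _ ≤ (κ ^ 2 - 1) * ((Real.sqrt (κ ^ 2 - 1))⁻¹) ^ 2 := by gcongr; exact h3
    _ = 1 := by rw [inv_pow, Real.sq_sqrt hk.le, mul_inv_cancel₀ hk.ne']

lemma Configuration.convex_cylinder (hC : Configuration κ Ω T τ₀ τ₁ ω) :
    Convex ℝ (sourceCylinder Ω τ₀) := by
  intro X hX X' hX' a b ha hb hab
  exact ⟨hC.source_convex hX.1 hX'.1 ha hb hab, convex_Icc 0 τ₀ hX.2 hX'.2 ha hb hab⟩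

end Config

/-! ### From local to global regularity for n ≥ 2. -/

section Global

variable {n : ℕ} {κ : ℝ}

/-- The slope at `Z` of the hyperboloid through `Z` with focus `Y`. -/
noncomputable def slopeTo (κ : ℝ) (Z Y : Space n) : Base n :=
  hypSlope κ Y (cFun κ Z Y) Z.fst

/-- The value of the square root at `Z` for the hyperboloid through `Z` with focus `Y`. -/
noncomputable def rootTo (κ : ℝ) (Z Y : Space n) : ℝ :=
  hypRoot κ Y (cFun κ Z Y) Z.fst

/-- Difference of the hyperboloid through `Z` and a height `h`, in factored form. -/
lemma phi_sub_mul (hκ : 1 < κ) {Z Y : Space n} (hc : 0 < cFun κ Z Y) (x : Base n) (h : ℝ) :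
    (phi κ x Y Z - h) * (hypRoot κ Y (cFun κ Z Y) x + rootTo κ Z Y - (h - Z.snd)) =
      2 * rootTo κ Z Y * (inner ℝ (slopeTo κ Z Y) (x - Z.fst) - (h - Z.snd))
        - (‖x - Z.fst‖ ^ 2 / (κ ^ 2 - 1) - (h - Z.snd) ^ 2) := by
  have h1 := hypRoot_sq_sub hκ Y hc Z.fst x
  have h2 := hyperboloid_cFun hκ Z Y
  rw [hyperboloid_eq] at h2
  rw [phi, hyperboloid_eq, ← h2, rootTo, slopeTo]
  -- With R the root at x and a = S - (h - zₙ₊₁), the two factors are a - R and a + R, so the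
  -- product is a² - R².
  linear_combination h1

lemma le_rootTo (hκ : 1 < κ) (Z Y : Space n) : cFun κ Z Y / (κ ^ 2 - 1) ≤ rootTo κ Z Y :=
  le_hypRoot hκ _ _ _

lemma rootTo_pos (hκ : 1 < κ) {Z Y : Space n} (hc : 0 < cFun κ Z Y) : 0 < rootTo κ Z Y :=
  hypRoot_pos hκ Y hc _

lemma hypRoot_sub_rootTo (hκ : 1 < κ) (Z Y : Space n) (x : Base n) :
    hypRoot κ Y (cFun κ Z Y) x - rootTo κ Z Y = -(phi κ x Y Z - Z.snd) := by
  have h2 := hyperboloid_cFun hκ Z Y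
  rw [hyperboloid_eq] at h2
  rw [phi, hyperboloid_eq, ← h2, rootTo]; ring

lemma abs_phi_sub_snd_le (hκ : 1 < κ) {Z Y : Space n} (hc : 0 < cFun κ Z Y) (x : Base n) :
    |phi κ x Y Z - Z.snd| ≤ (Real.sqrt (κ ^ 2 - 1))⁻¹ * ‖x - Z.fst‖ := by
  have h := abs_hyperboloid_sub_le hκ Y hc Z.fst x
  rwa [hyperboloid_cFun hκ] at h

lemma continuous_phi (hκ : 1 < κ) {Z Y : Space n} (hc : 0 < cFun κ Z Y) :
    Continuous fun x => phi κ x Y Z :=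
  continuous_iff_continuousAt.2 fun x =>
    (hasGradientAt_hyperboloid hκ Y hc x).differentiableAt.continuousAt

/-- The factor in front of |x - z|² is less than 1, which keeps |x - z|²/(κ² - 1) - (φ - zₙ₊₁)²
comparable to |x - z|². -/
lemma sq_phi_sub_snd_le (hκ : 1 < κ) {Z Y : Space n} {b₀ D : ℝ} (hb₀ : 0 < b₀)
    (hc : b₀ ≤ cFun κ Z Y) {x : Base n} (hx : ‖x - Y.fst‖ ≤ D) (hz : ‖Z.fst - Y.fst‖ ≤ D) :
    (κ ^ 2 - 1) * (phi κ x Y Z - Z.snd) ^ 2 ≤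
      D ^ 2 / (b₀ ^ 2 / (κ ^ 2 - 1) + D ^ 2) * ‖x - Z.fst‖ ^ 2 := by
  have hk := kappa_sq_sub_one_pos hκ
  set θ := D ^ 2 / (b₀ ^ 2 / (κ ^ 2 - 1) + D ^ 2)
  have hθ : 0 ≤ θ := by positivity
  have key : ∀ x', ‖x' - Y.fst‖ ≤ D →
      ‖hypSlope κ Y (cFun κ Z Y) x'‖ ≤ Real.sqrt (θ / (κ ^ 2 - 1)) := fun x' hx' =>
    Real.le_sqrt_of_sq_le (by
      rw [le_div_iff₀ hk, mul_comm]; exact mul_norm_hypSlope_sq_le hκ Y hb₀ hc hx')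
  have h := abs_hyperboloid_sub_le_of_slope hκ Y (hb₀.trans_le hc) (key _ hz) (key _ hx)
  rw [hyperboloid_cFun hκ] at h
  have h2 : (phi κ x Y Z - Z.snd) ^ 2 ≤ (Real.sqrt (θ / (κ ^ 2 - 1)) * ‖x - Z.fst‖) ^ 2 := by
    rw [← sq_abs]; gcongr; exact h
  rw [mul_pow, Real.sq_sqrt (by positivity)] at h2
  calc _ ≤ (κ ^ 2 - 1) * (θ / (κ ^ 2 - 1) * ‖x - Z.fst‖ ^ 2) := by gcongr
    _ = _ := by field_simp

variable {τ₀ τ₁ ω : ℝ} {Ω : Set (Base n)} {T : Set (Space n)}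

/-- The inequality defining regularity, in terms of curvatures: it forces the curvature
`1 / (2S)` to be uniformly convex along refractor segments. -/
lemma Configuration.curvature_gap (hC : Configuration κ Ω T τ₀ τ₁ ω) (hn : 2 ≤ n)
    {Z Y₁ Y₂ Y : Space n} (hZ : Z ∈ sourceCylinder Ω τ₀) (hY₁ : Y₁ ∈ T) (hY₂ : Y₂ ∈ T)
    (hY : Y ∈ T) (hne : Y₁ ≠ Y₂) {l : ℝ}
    (hslope : slopeTo κ Z Y = (1 - l) • slopeTo κ Z Y₁ + l • slopeTo κ Z Y₂)
    {A C₂ : ℝ} (hA : 0 < A) (hC₂ : 0 < C₂)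
    (hreg : ∀ x ∈ Ω, ‖x - Z.fst‖ ≤ C₂ →
      phi κ x Y Z ≤ max (phi κ x Y₁ Z) (phi κ x Y₂ Z) - A * ‖x - Z.fst‖ ^ 2) :
    (κ ^ 2 - 1) * A / 2 ≤ 1 / (2 * rootTo κ Z Y)
      - ((1 - l) * (1 / (2 * rootTo κ Z Y₁)) + l * (1 / (2 * rootTo κ Z Y₂))) := by
  have hκ := hC.one_lt_kappa
  have hk := kappa_sq_sub_one_pos hκ
  have hc := hC.cFun_pos hZ hY
  have hc₁ := hC.cFun_pos hZ hY₁
  have hc₂ := hC.cFun_pos hZ hY₂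
  have hS := rootTo_pos hκ hc
  have hS₁ := rootTo_pos hκ hc₁
  have hS₂ := rootTo_pos hκ hc₂
  set S := rootTo κ Z Y with hSdef
  set S₁ := rootTo κ Z Y₁ with hS₁def
  set S₂ := rootTo κ Z Y₂ with hS₂def
  set v := slopeTo κ Z Y
  set v₁ := slopeTo κ Z Y₁ with hv₁
  set v₂ := slopeTo κ Z Y₂ with hv₂
  set ℓ := (Real.sqrt (κ ^ 2 - 1))⁻¹ with hℓ
  have hℓ0 : 0 < ℓ := inv_pos.2 (Real.sqrt_pos.2 hk)
  set ρ := 1 / (2 * S) with hρ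
  set ρ₁ := 1 / (2 * S₁) with hρ₁
  set ρ₂ := 1 / (2 * S₂) with hρ₂
  have hd : 0 < ‖v₁ - v₂‖ :=
    norm_pos_iff.2 (sub_ne_zero.2 fun h => hne (hC.slope_injective hZ hY₁ hY₂ h))
  obtain ⟨r₀, hr₀, hball⟩ := Metric.isOpen_iff.1 hC.source_open Z.fst hZ.1
  -- The radius is so small that the second factor in `phi_sub_mul` is at least Sᵢ, and that the
  -- linear part of `g` below dominates at the two poles of the sphere.
  have hlim : ∃ r : ℝ, 0 < r ∧ r < r₀ ∧ r ≤ C₂ ∧ 2 * ℓ * r ≤ S₁ ∧ 2 * ℓ * r ≤ S₂ ∧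
      |ρ₁ - ρ₂| * (r / (κ ^ 2 - 1)) < ‖v₁ - v₂‖ := by
    have t : ∀ c : ℝ, Filter.Tendsto (fun r : ℝ => c * r) (𝓝[>] 0) (𝓝 0) := fun c => by
      have : Continuous fun r : ℝ => c * r := by fun_prop
      simpa using (this.tendsto 0).mono_left nhdsWithin_le_nhds
    have e0 : ∀ᶠ r in 𝓝[>] (0 : ℝ), 0 < r := self_mem_nhdsWithin
    have e1 := (t 1).eventually (gt_mem_nhds hr₀)
    have e2 := (t 1).eventually (gt_mem_nhds hC₂)
    have e3 := (t (2 * ℓ)).eventually (gt_mem_nhds hS₁)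
    have e4 := (t (2 * ℓ)).eventually (gt_mem_nhds hS₂)
    have e5 := (t (|ρ₁ - ρ₂| / (κ ^ 2 - 1))).eventually (gt_mem_nhds hd)
    obtain ⟨r, f0, f1, f2, f3, f4, f5⟩ :=
      (e0.and (e1.and (e2.and (e3.and (e4.and e5))))).exists
    refine ⟨r, f0, by linarith, by linarith, f3.le, f4.le, ?_⟩
    calc _ = |ρ₁ - ρ₂| / (κ ^ 2 - 1) * r := by ring
      _ < _ := f5
  obtain ⟨r, hr, hrr, hrC, hrS₁, hrS₂, hrd⟩ := hlim
  set q : Base n → ℝ := fun x => ‖x - Z.fst‖ ^ 2 / (κ ^ 2 - 1) - (phi κ x Y Z - Z.snd) ^ 2 with hq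
  have hq_nonneg : ∀ x, 0 ≤ q x := fun x => by
    have h := abs_phi_sub_snd_le hκ hc x
    have h2 : (phi κ x Y Z - Z.snd) ^ 2 ≤ (ℓ * ‖x - Z.fst‖) ^ 2 := by rw [← sq_abs]; gcongr
    rw [mul_pow, hℓ, inv_pow, Real.sq_sqrt hk.le, inv_mul_eq_div] at h2
    exact sub_nonneg.2 h2
  have hq_le : ∀ x, q x ≤ ‖x - Z.fst‖ ^ 2 / (κ ^ 2 - 1) := fun x =>
    sub_le_self _ (sq_nonneg _)
  -- By `phi_sub_mul`, φ(x, Yᵢ, Z) - φ(x, Y, Z) is, up to a positive factor for small r, the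
  -- quantity Fᵢ = ⟨vᵢ, x - z⟩ - (φ(x, Y, Z) - zₙ₊₁) - ρᵢ q(x). Here g = F₁ - F₂.
  set g : Base n → ℝ := fun x => inner ℝ (v₁ - v₂) (x - Z.fst) - (ρ₁ - ρ₂) * q x with hg
  have hgc : Continuous g := by
    have := continuous_phi hκ hc
    fun_prop
  have hqr : ∀ x ∈ Metric.sphere Z.fst r, |(ρ₁ - ρ₂) * q x| < r * ‖v₁ - v₂‖ := fun x hx => by
    have h := hq_le x
    rw [mem_sphere_iff_norm.1 hx] at h
    rw [abs_mul, abs_of_nonneg (hq_nonneg x)]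
    calc _ ≤ |ρ₁ - ρ₂| * (r ^ 2 / (κ ^ 2 - 1)) := by gcongr
      _ = r * (|ρ₁ - ρ₂| * (r / (κ ^ 2 - 1))) := by ring
      _ < _ := by gcongr
  have hmem : ∀ s : ℝ, |s| = 1 → Z.fst + (s * (r / ‖v₁ - v₂‖)) • (v₁ - v₂) ∈
      Metric.sphere Z.fst r := fun s hs => by
    rw [mem_sphere_iff_norm, add_sub_cancel_left, norm_smul, Real.norm_eq_abs, abs_mul, hs, one_mul,
      abs_of_pos (div_pos hr hd), div_mul_cancel₀ _ hd.ne']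
  have hinner : ∀ s : ℝ, inner ℝ (v₁ - v₂)
      (Z.fst + (s * (r / ‖v₁ - v₂‖)) • (v₁ - v₂) - Z.fst) = s * (r * ‖v₁ - v₂‖) := fun s => by
    rw [add_sub_cancel_left, real_inner_smul_right, real_inner_self_eq_norm_sq]
    field_simp
  -- The sphere is connected only for n ≥ 2; this is what produces a zero of g on it.
  have hrank : 1 < Module.rank ℝ (Base n) := by
    rw [← Module.finrank_eq_rank, finrank_euclideanSpace_fin]
    exact_mod_cast hn
  have hivt := (isPreconnected_sphere hrank Z.fst r).intermediate_value
    (hmem (-1) (by norm_num)) (hmem 1 (by norm_num)) hgc.continuousOn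
  have hg1 : 0 < g (Z.fst + ((1 : ℝ) * (r / ‖v₁ - v₂‖)) • (v₁ - v₂)) := by
    have := (abs_lt.1 (hqr _ (hmem 1 (by norm_num)))).2
    simp only [hg]
    rw [hinner]; linarith
  have hg2 : g (Z.fst + ((-1 : ℝ) * (r / ‖v₁ - v₂‖)) • (v₁ - v₂)) < 0 := by
    have := (abs_lt.1 (hqr _ (hmem (-1) (by norm_num)))).1
    simp only [hg]
    rw [hinner]; linarith
  obtain ⟨x, hx, hgx⟩ := hivt ⟨hg2.le, hg1.le⟩
  have hxr := mem_sphere_iff_norm.1 hx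
  have hxΩ : x ∈ Ω := hball (by rw [mem_ball_iff_norm, hxr]; exact hrr)
  have hloc := hreg x hxΩ (by rw [hxr]; exact hrC)
  have hI := phi_sub_mul hκ hc x (phi κ x Y Z)
  have hI₁ := phi_sub_mul hκ hc₁ x (phi κ x Y Z)
  have hI₂ := phi_sub_mul hκ hc₂ x (phi κ x Y Z)
  have hR₁ := hypRoot_sub_rootTo hκ Z Y₁ x
  have hR₂ := hypRoot_sub_rootTo hκ Z Y₂ x
  have hb := abs_le.1 (abs_phi_sub_snd_le hκ hc x)
  have hb₁ := abs_le.1 (abs_phi_sub_snd_le hκ hc₁ x)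
  have hb₂ := abs_le.1 (abs_phi_sub_snd_le hκ hc₂ x)
  rw [hxr] at hloc hb hb₁ hb₂
  change _ = 2 * S * (inner ℝ v (x - Z.fst) - _) - q x at hI
  change _ = 2 * S₁ * (inner ℝ v₁ (x - Z.fst) - _) - q x at hI₁
  change _ = 2 * S₂ * (inner ℝ v₂ (x - Z.fst) - _) - q x at hI₂
  rw [hslope, inner_add_left, real_inner_smul_left, real_inner_smul_left] at hI
  have hgx' : inner ℝ v₁ (x - Z.fst) - inner ℝ v₂ (x - Z.fst) = (ρ₁ - ρ₂) * q x := by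
    have : inner ℝ (v₁ - v₂) (x - Z.fst) - (ρ₁ - ρ₂) * q x = 0 := hgx
    rw [inner_sub_left] at this; linarith
  have hqx := hq_nonneg x
  have hqx' := hq_le x
  rw [hxr] at hqx'
  set Q := q x
  set e := phi κ x Y Z
  set p₁ := inner ℝ v₁ (x - Z.fst)
  set p₂ := inner ℝ v₂ (x - Z.fst)
  have hF : (1 - l) * p₁ + l * p₂ - (e - Z.snd) = ρ * Q := by
    rw [sub_self, zero_mul] at hI
    rw [hρ]; field_simp; linarith
  -- Where g vanishes, F₁ and F₂ both equal their convex combination, which is the curvature gap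
  -- times Q. So it does not matter which hyperboloid realizes the maximum.
  have hF₁ : p₁ - (e - Z.snd) - ρ₁ * Q = (ρ - ((1 - l) * ρ₁ + l * ρ₂)) * Q := by
    linear_combination hF + l * hgx'
  have hF₂ : p₂ - (e - Z.snd) - ρ₂ * Q = (ρ - ((1 - l) * ρ₁ + l * ρ₂)) * Q := by
    linear_combination hF - (1 - l) * hgx'
  have fin : ∀ S' ρ' p' f w : ℝ, 0 < S' → ρ' = 1 / (2 * S') →
      p' - (e - Z.snd) - ρ' * Q = (ρ - ((1 - l) * ρ₁ + l * ρ₂)) * Q →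
      (f - e) * w = 2 * S' * (p' - (e - Z.snd)) - Q → S' ≤ w → e + A * r ^ 2 ≤ f →
      (κ ^ 2 - 1) * A / 2 ≤ ρ - ((1 - l) * ρ₁ + l * ρ₂) := by
    intro S' ρ' p' f w hS' hρ' h1 h2 h3 h4
    set G := ρ - ((1 - l) * ρ₁ + l * ρ₂)
    have h5 : (f - e) * w = 2 * S' * (G * Q) := by
      rw [h2, ← h1, hρ']; field_simp
    have h6 : A * r ^ 2 * S' ≤ (f - e) * w := by
      have : 0 ≤ A * r ^ 2 := by positivity
      exact mul_le_mul (by linarith) h3 hS'.le (by linarith)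
    have h7 : A * r ^ 2 / 2 ≤ G * Q := by
      rw [h5] at h6
      have : S' * (A * r ^ 2 / 2) ≤ S' * (G * Q) := by linarith
      exact le_of_mul_le_mul_left this hS'
    have h8 : 0 < G * Q := lt_of_lt_of_le (by positivity) h7
    have hG : 0 < G := by
      by_contra hG
      exact absurd h8 (not_lt.2 (mul_nonpos_of_nonpos_of_nonneg (not_lt.1 hG) hqx))
    have h9 : A * r ^ 2 / 2 ≤ G * (r ^ 2 / (κ ^ 2 - 1)) := h7.trans (by gcongr)
    have h10 : r ^ 2 * ((κ ^ 2 - 1) * A / 2) ≤ r ^ 2 * G := by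
      have := mul_le_mul_of_nonneg_left h9 hk.le
      calc _ = (κ ^ 2 - 1) * (A * r ^ 2 / 2) := by ring
        _ ≤ _ := this
        _ = _ := by field_simp
    exact le_of_mul_le_mul_left h10 (by positivity)
  rcases le_total (phi κ x Y₁ Z) (phi κ x Y₂ Z) with hm | hm
  · rw [max_eq_right hm] at hloc
    exact fin S₂ ρ₂ p₂ _ _ hS₂ hρ₂ hF₂ hI₂ (by linarith) (by linarith)
  · rw [max_eq_left hm] at hloc
    exact fin S₁ ρ₁ p₁ _ _ hS₁ hρ₁ hF₁ hI₁ (by linarith) (by linarith)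

/-- The constant in the global form of the regularity inequality. -/
noncomputable def globalConst (κ b₀ D A : ℝ) : ℝ :=
  A / 2 * (1 - D ^ 2 / (b₀ ^ 2 / (κ ^ 2 - 1) + D ^ 2))
    / (1 + (Real.sqrt (κ ^ 2 - 1))⁻¹ * (2 * D) / (b₀ / (κ ^ 2 - 1)))

/-- For `n ≥ 2` the inequality defining regularity holds on all of `Ω` once it holds locally. -/
lemma Configuration.regular_global (hC : Configuration κ Ω T τ₀ τ₁ ω) (hn : 2 ≤ n)
    {Z Y₁ Y₂ Y : Space n} (hZ : Z ∈ sourceCylinder Ω τ₀) (hY₁ : Y₁ ∈ T) (hY₂ : Y₂ ∈ T)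
    (hY : Y ∈ T) (hne : Y₁ ≠ Y₂) {l : ℝ} (hl : l ∈ Icc (0 : ℝ) 1)
    (hslope : slopeTo κ Z Y = (1 - l) • slopeTo κ Z Y₁ + l • slopeTo κ Z Y₂)
    {b₀ A C₂ : ℝ} (hb₀ : 0 < b₀) (hb : ∀ Y ∈ T, b₀ ≤ cFun κ Z Y) (hA : 0 < A) (hC₂ : 0 < C₂)
    (hreg : ∀ x ∈ Ω, ‖x - Z.fst‖ ≤ C₂ →
      phi κ x Y Z ≤ max (phi κ x Y₁ Z) (phi κ x Y₂ Z) - A * ‖x - Z.fst‖ ^ 2) {x : Base n}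
    (hx : x ∈ Ω) :
    phi κ x Y Z ≤ max (phi κ x Y₁ Z) (phi κ x Y₂ Z)
      - globalConst κ b₀ (bigDelta Ω T) A * ‖x - Z.fst‖ ^ 2 := by
  have hgap := hC.curvature_gap hn hZ hY₁ hY₂ hY hne hslope hA hC₂ hreg
  have hκ := hC.one_lt_kappa
  have hk := kappa_sq_sub_one_pos hκ
  have hc := hC.cFun_pos hZ hY
  have hS := rootTo_pos hκ hc
  set D := bigDelta Ω T with hD
  have hxD := hC.norm_sub_le_bigDelta hx hY
  have hzD := hC.norm_sub_le_bigDelta hZ.1 hY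
  have hD0 : 0 ≤ D := (norm_nonneg _).trans hxD
  set a₀ := b₀ / (κ ^ 2 - 1) with ha₀
  have ha₀pos : 0 < a₀ := div_pos hb₀ hk
  set ℓ := (Real.sqrt (κ ^ 2 - 1))⁻¹ with hℓ
  have hℓ0 : 0 < ℓ := inv_pos.2 (Real.sqrt_pos.2 hk)
  have hxz : ‖x - Z.fst‖ ≤ 2 * D := by
    have : x - Z.fst = (x - Y.fst) - (Z.fst - Y.fst) := by abel
    rw [this]
    exact (norm_sub_le _ _).trans (by linarith)
  have hsq := sq_phi_sub_snd_le hκ hb₀ (hb Y hY) hxD hzD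
  set θ := D ^ 2 / (b₀ ^ 2 / (κ ^ 2 - 1) + D ^ 2) with hθ
  have hθ1 : θ ≤ 1 := div_le_one_of_le₀ (by
    have : 0 ≤ b₀ ^ 2 / (κ ^ 2 - 1) := by positivity
    linarith) (by positivity)
  set e := phi κ x Y Z with he
  set Q := ‖x - Z.fst‖ ^ 2 / (κ ^ 2 - 1) - (e - Z.snd) ^ 2 with hQ
  have hQle : (1 - θ) * ‖x - Z.fst‖ ^ 2 / (κ ^ 2 - 1) ≤ Q := by
    rw [hQ, div_le_iff₀ hk, sub_mul (‖x - Z.fst‖ ^ 2 / (κ ^ 2 - 1)), div_mul_cancel₀ _ hk.ne']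
    linarith
  have hQ0 : 0 ≤ Q := le_trans (div_nonneg (mul_nonneg (by linarith) (by positivity)) hk.le) hQle
  have hI := phi_sub_mul hκ hc x e
  rw [hslope, inner_add_left, real_inner_smul_left, real_inner_smul_left, ← he, ← hQ, sub_self,
    zero_mul] at hI
  have hF : (1 - l) * inner ℝ (slopeTo κ Z Y₁) (x - Z.fst) +
      l * inner ℝ (slopeTo κ Z Y₂) (x - Z.fst) - (e - Z.snd) = 1 / (2 * rootTo κ Z Y) * Q := by
    field_simp; linarith
  set E := A / 2 * (1 - θ) * ‖x - Z.fst‖ ^ 2 with hE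
  have hE0 : 0 ≤ E := by
    have : 0 ≤ 1 - θ := by linarith
    positivity
  have hEQ : E ≤ (κ ^ 2 - 1) * A / 2 * Q := by
    calc E = (κ ^ 2 - 1) * A / 2 * ((1 - θ) * ‖x - Z.fst‖ ^ 2 / (κ ^ 2 - 1)) := by
          rw [hE]; field_simp
      _ ≤ _ := by gcongr
  have hW : 0 < 1 + ℓ * (2 * D) / a₀ := by positivity
  have one : ∀ Y' ∈ T, E ≤ inner ℝ (slopeTo κ Z Y') (x - Z.fst) - (e - Z.snd)
      - 1 / (2 * rootTo κ Z Y') * Q → e + E / (1 + ℓ * (2 * D) / a₀) ≤ phi κ x Y' Z := by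
    intro Y' hY' h1
    have hc' := hC.cFun_pos hZ hY'
    have hS' := rootTo_pos hκ hc'
    have hI' := phi_sub_mul hκ hc' x e
    have hR' := hypRoot_sub_rootTo hκ Z Y' x
    have hb' := abs_le.1 (abs_phi_sub_snd_le hκ hc' x)
    have hbe := abs_le.1 (abs_phi_sub_snd_le hκ hc x)
    have ha' : a₀ ≤ rootTo κ Z Y' :=
      le_trans (by rw [ha₀]; gcongr; exact hb Y' hY') (le_rootTo hκ Z Y')
    rw [← hQ] at hI'
    set S' := rootTo κ Z Y'
    set w := hypRoot κ Y' (cFun κ Z Y') x + S' - (e - Z.snd) with hw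
    have hlx : ℓ * ‖x - Z.fst‖ ≤ ℓ * (2 * D) := by gcongr
    have hw2 : w ≤ 2 * S' * (1 + ℓ * (2 * D) / a₀) := by
      have : ℓ * (2 * D) ≤ S' * (ℓ * (2 * D) / a₀) := by
        rw [← mul_div_assoc, le_div_iff₀ ha₀pos, mul_comm]; gcongr
      have h2 : 2 * S' * (1 + ℓ * (2 * D) / a₀) = 2 * S' + 2 * (S' * (ℓ * (2 * D) / a₀)) := by ring
      linarith
    -- No smallness of |x - z| is available here. Positivity comes from the triangle inequality
    -- through y', the bound |x - y'| ≤ √(κ² - 1) R, and its strict version at z.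
    have hw0 : 0 < w := by
      have h2 : ‖x - Z.fst‖ ≤ Real.sqrt (κ ^ 2 - 1) * hypRoot κ Y' (cFun κ Z Y') x +
          ‖Z.fst - Y'.fst‖ := by
        have : x - Z.fst = (x - Y'.fst) - (Z.fst - Y'.fst) := by abel
        rw [this]
        exact (norm_sub_le _ _).trans (by
          gcongr; exact norm_sub_le_sqrt_mul_hypRoot hκ Y' _ x)
      have h3 : ‖Z.fst - Y'.fst‖ < Real.sqrt (κ ^ 2 - 1) * S' := by
        refine lt_of_pow_lt_pow_left₀ 2 (by positivity) ?_
        have h4 : S' ^ 2 = _ := hypRoot_sq hκ Y' (cFun κ Z Y') Z.fst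
        rw [mul_pow, Real.sq_sqrt hk.le, h4, mul_add, mul_div_cancel₀ _ hk.ne']
        have : 0 < (κ ^ 2 - 1) * (cFun κ Z Y' / (κ ^ 2 - 1)) ^ 2 := by positivity
        linarith
      have h5 : ℓ * ‖x - Z.fst‖ < hypRoot κ Y' (cFun κ Z Y') x + S' := by
        rw [hℓ, inv_mul_lt_iff₀ (Real.sqrt_pos.2 hk)]
        linarith
      linarith
    have h6 : (phi κ x Y' Z - e) * w = 2 * S' * (inner ℝ (slopeTo κ Z Y') (x - Z.fst)
        - (e - Z.snd) - 1 / (2 * S') * Q) := by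
      rw [hI']; field_simp
    have h7 : 2 * S' * E ≤ (phi κ x Y' Z - e) * w := by rw [h6]; gcongr
    have h8 : 0 ≤ phi κ x Y' Z - e := by
      by_contra h
      have : (phi κ x Y' Z - e) * w < 0 := mul_neg_of_neg_of_pos (not_le.1 h) hw0
      have : 0 ≤ 2 * S' * E := by positivity
      linarith
    have h9 : 2 * S' * E ≤ (phi κ x Y' Z - e) * (2 * S' * (1 + ℓ * (2 * D) / a₀)) :=
      h7.trans (by gcongr)
    have h10 : E ≤ (phi κ x Y' Z - e) * (1 + ℓ * (2 * D) / a₀) := by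
      refine le_of_mul_le_mul_left ?_ (by positivity : 0 < 2 * S')
      linarith
    rw [← div_le_iff₀ hW] at h10
    linarith
  have hconst : globalConst κ b₀ D A * ‖x - Z.fst‖ ^ 2 = E / (1 + ℓ * (2 * D) / a₀) := by
    rw [globalConst, hE]; ring
  rw [hconst, le_sub_iff_add_le]
  set G := 1 / (2 * rootTo κ Z Y)
      - ((1 - l) * (1 / (2 * rootTo κ Z Y₁)) + l * (1 / (2 * rootTo κ Z Y₂))) with hG
  have hEG : E ≤ G * Q := hEQ.trans (by gcongr)
  by_cases h1 : E ≤ inner ℝ (slopeTo κ Z Y₁) (x - Z.fst) - (e - Z.snd)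
      - 1 / (2 * rootTo κ Z Y₁) * Q
  · exact (one Y₁ hY₁ h1).trans (le_max_left _ _)
  · refine (one Y₂ hY₂ ?_).trans (le_max_right _ _)
    by_contra h2
    rw [not_le] at h1 h2
    -- The convex combination of the two quantities is G Q ≥ E, so they cannot both be less than E.
    have h3 : (1 - l) * (inner ℝ (slopeTo κ Z Y₁) (x - Z.fst) - (e - Z.snd)
        - 1 / (2 * rootTo κ Z Y₁) * Q) + l * (inner ℝ (slopeTo κ Z Y₂) (x - Z.fst) - (e - Z.snd)
        - 1 / (2 * rootTo κ Z Y₂) * Q) = G * Q := by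
      rw [hG]; linear_combination hF
    rw [← h3] at hEG
    exact absurd (convex_Iio E h1 h2 (sub_nonneg.2 hl.2) hl.1 (sub_add_cancel 1 l))
      (not_lt.2 hEG)

end Global

/-! ### The one-dimensional substitute: single crossing of hyperboloids. -/

section Line

variable {n : ℕ} {κ τ₀ τ₁ ω : ℝ} {Ω : Set (Base n)} {T : Set (Space n)}

lemma hyperboloid_le_hyperboloid (hκ : 1 < κ) (Y : Space n) {b b' : ℝ} (hb' : 0 ≤ b')
    (h : b' ≤ b) (x : Base n) : hyperboloid κ Y b x ≤ hyperboloid κ Y b' x := by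
  rw [hyperboloid_le_iff hκ Y (hb'.trans h), cFun_hyperboloid hκ Y hb']
  exact h

lemma Configuration.continuousOn_slopeTo (hC : Configuration κ Ω T τ₀ τ₁ ω) {Y : Space n}
    (hY : Y ∈ T) : ContinuousOn (fun X => slopeTo κ X Y) (sourceCylinder Ω τ₀) := by
  have hκ := hC.one_lt_kappa
  simp only [slopeTo, hypSlope_cFun hκ]
  have h1 : Continuous fun X : Space n => κ * ‖X - Y‖ - (Y.snd - X.snd) := by fun_prop
  have h2 : Continuous fun X : Space n => Y.fst - X.fst := by fun_prop
  refine (h1.continuousOn.inv₀ fun X hX => ?_).smul h2.continuousOn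
  have := snd_lt_kappa_mul_norm_sub hκ (hC.snd_lt hX hY)
  linarith

lemma Configuration.isPreconnected_cylinder (hC : Configuration κ Ω T τ₀ τ₁ ω) :
    IsPreconnected (sourceCylinder Ω τ₀) :=
  @Convex.isPreconnected (Space n) _ _ _ _ IsBoundedSMul.continuousSMul _ hC.convex_cylinder

/-- On the line, the slopes belonging to two target points are ordered in the same way from all
points of the cylinder. -/
lemma Configuration.slope_order (hC : Configuration κ Ω T τ₀ τ₁ ω) (hn : n = 1)
    {Y Y' : Space n} (hY : Y ∈ T) (hY' : Y' ∈ T) (hne : Y ≠ Y') {w : Base n} (hw : w ≠ 0) :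
    (∀ X ∈ sourceCylinder Ω τ₀, 0 < inner ℝ (slopeTo κ X Y - slopeTo κ X Y') w) ∨
      ∀ X ∈ sourceCylinder Ω τ₀, inner ℝ (slopeTo κ X Y - slopeTo κ X Y') w < 0 := by
  have hcont : ContinuousOn (fun X => inner ℝ (slopeTo κ X Y - slopeTo κ X Y') w)
      (sourceCylinder Ω τ₀) :=
    ((hC.continuousOn_slopeTo hY).sub (hC.continuousOn_slopeTo hY')).inner continuousOn_const
  -- In dimension one, orthogonality to w ≠ 0 forces the slopes to agree, hence the targets. A
  -- continuous function without zeros on the connected cylinder has constant sign.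
  have hnz : ∀ X ∈ sourceCylinder Ω τ₀, inner ℝ (slopeTo κ X Y - slopeTo κ X Y') w ≠ 0 := by
    intro X hX h
    refine hne (hC.slope_injective hX hY hY' (sub_eq_zero.1 ?_))
    subst hn
    change slopeTo κ X Y - slopeTo κ X Y' = 0
    generalize slopeTo κ X Y - slopeTo κ X Y' = d at h
    rw [PiLp.inner_apply, Fin.sum_univ_one] at h
    have hw0 : w 0 ≠ 0 := fun h0 => hw (by ext i; rw [Subsingleton.elim i 0, h0]; rfl)
    have hd0 : d 0 = 0 := by
      have h' : w 0 * d 0 = 0 := by simpa using h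
      exact (mul_eq_zero.1 h').resolve_left hw0
    ext i
    rw [Subsingleton.elim i 0, hd0]; rfl
  by_contra! hcon
  obtain ⟨⟨X, hX, h1⟩, X', hX', h2⟩ := hcon
  obtain ⟨X₀, hX₀, h0⟩ := hC.isPreconnected_cylinder.intermediate_value hX hX' hcont
    ⟨h1, h2⟩
  exact hnz X₀ hX₀ h0

lemma hyperboloid_nonneg_of_mem_segment (hκ : 1 < κ) (Y : Space n) {b : ℝ} (hb : 0 < b)
    {x₀ w : Base n} (h0 : 0 ≤ hyperboloid κ Y b x₀) (h1 : 0 ≤ hyperboloid κ Y b (x₀ + w))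
    {t : ℝ} (ht : t ∈ Icc (0 : ℝ) 1) : 0 ≤ hyperboloid κ Y b (x₀ + t • w) := by
  have e0 := hyperboloid_le_tangent hκ Y hb (x₀ + t • w) x₀
  have e1 := hyperboloid_le_tangent hκ Y hb (x₀ + t • w) (x₀ + w)
  rw [show x₀ - (x₀ + t • w) = (-t) • w by module, real_inner_smul_right] at e0
  rw [show x₀ + w - (x₀ + t • w) = (1 - t) • w by module, real_inner_smul_right] at e1
  have e2 := mul_nonneg (sub_nonneg.2 ht.2) (h0.trans e0)
  have e3 := mul_nonneg ht.1 (h1.trans e1)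
  linarith

lemma hasDerivAt_hyperboloid_line (hκ : 1 < κ) (Y : Space n) {b : ℝ} (hb : 0 < b)
    (x₀ w : Base n) (t : ℝ) : HasDerivAt (fun t : ℝ => hyperboloid κ Y b (x₀ + t • w))
      (inner ℝ (hypSlope κ Y b (x₀ + t • w)) w) t := by
  have h1 := (hasGradientAt_hyperboloid hκ Y hb (x₀ + t • w)).hasFDerivAt
  have h2 : HasDerivAt (fun t : ℝ => x₀ + t • w) w t := by
    simpa using ((hasDerivAt_id t).smul_const w).const_add x₀
  have h3 := h1.comp_hasDerivAt t h2
  rw [InnerProductSpace.toDual_apply_apply] at h3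
  exact h3

/-- On the line, two hyperboloids with different foci in the target do not cross twice within
the cylinder. -/
lemma Configuration.hyperboloid_le_on_segment (hC : Configuration κ Ω T τ₀ τ₁ ω) (hn : n = 1)
    {Y Y' : Space n} (hY : Y ∈ T) (hY' : Y' ∈ T) {b b' : ℝ} (hb : 0 < b) (hb' : 0 < b')
    {x₀ w : Base n} (hx₀ : x₀ ∈ Ω) (hx₁ : x₀ + w ∈ Ω)
    (hτ : ∀ x ∈ Ω, hyperboloid κ Y' b' x ≤ τ₀)
    (h₀ : 0 ≤ hyperboloid κ Y b x₀) (h₁ : 0 ≤ hyperboloid κ Y b (x₀ + w))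
    (hle₀ : hyperboloid κ Y' b' x₀ ≤ hyperboloid κ Y b x₀)
    (hle₁ : hyperboloid κ Y' b' (x₀ + w) ≤ hyperboloid κ Y b (x₀ + w)) {t : ℝ}
    (ht : t ∈ Icc (0 : ℝ) 1) :
    hyperboloid κ Y' b' (x₀ + t • w) ≤ hyperboloid κ Y b (x₀ + t • w) := by
  have hκ := hC.one_lt_kappa
  rcases eq_or_ne Y Y' with rfl | hne
  · rw [hyperboloid_le_iff hκ Y hb'.le, cFun_hyperboloid hκ Y hb.le] at hle₀
    exact hyperboloid_le_hyperboloid hκ Y hb.le hle₀ _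
  rcases eq_or_ne w 0 with rfl | hw
  · simpa using hle₀
  set ψ : ℝ → ℝ := fun t => hyperboloid κ Y b (x₀ + t • w) - hyperboloid κ Y' b' (x₀ + t • w)
    with hψ
  set ψ' : ℝ → ℝ := fun t => inner ℝ (hypSlope κ Y b (x₀ + t • w)) w -
    inner ℝ (hypSlope κ Y' b' (x₀ + t • w)) w with hψ'
  have hder : ∀ t, HasDerivAt ψ (ψ' t) t := fun t =>
    (hasDerivAt_hyperboloid_line hκ Y hb x₀ w t).sub
      (hasDerivAt_hyperboloid_line hκ Y' hb' x₀ w t)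
  -- At a crossing both hyperboloids pass through a common point of the cylinder: its height is
  -- nonnegative by concavity of the first one and at most τ₀ by the bound on the second. So
  -- `slope_order` fixes the sign of ψ' there.
  have hcross : ∀ t ∈ Icc (0 : ℝ) 1, ψ t = 0 → ∃ X ∈ sourceCylinder Ω τ₀,
      ψ' t = inner ℝ (slopeTo κ X Y - slopeTo κ X Y') w := by
    intro t ht h
    have heq : hyperboloid κ Y b (x₀ + t • w) = hyperboloid κ Y' b' (x₀ + t • w) := sub_eq_zero.1 h
    have hmem : x₀ + t • w ∈ Ω := by
      have := hC.source_convex hx₀ hx₁ (sub_nonneg.2 ht.2) ht.1 (sub_add_cancel 1 t)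
      rwa [show (1 - t) • x₀ + t • (x₀ + w) = x₀ + t • w by module] at this
    refine ⟨pt (x₀ + t • w) (hyperboloid κ Y b (x₀ + t • w)), ⟨hmem,
      hyperboloid_nonneg_of_mem_segment hκ Y hb h₀ h₁ ht, ?_⟩, ?_⟩
    · rw [pt_snd, heq]; exact hτ _ hmem
    · rw [slopeTo, slopeTo, cFun_hyperboloid hκ Y hb.le, heq, cFun_hyperboloid hκ Y' hb'.le,
        pt_fst, inner_sub_left]
  suffices h : 0 ≤ ψ t from sub_nonneg.1 h
  rcases hC.slope_order hn hY hY' hne hw with hs | hs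
  · refine image_le_of_deriv_right_lt_deriv_boundary (f := fun _ => (0 : ℝ)) (f' := fun _ => 0)
      (B := ψ) (B' := ψ') continuousOn_const (fun t _ => hasDerivWithinAt_const _ _ _) ?_ hder
      (fun t ht h => ?_) ht
    · simpa [hψ] using hle₀
    · obtain ⟨X, hX, e⟩ := hcross t (Ico_subset_Icc_self ht) h.symm
      rw [e]; exact hs X hX
  -- For the opposite sign, the same barrier argument runs backward from the other end point.
  · have hmain := image_le_of_deriv_right_lt_deriv_boundary (f := fun _ => (0 : ℝ))
      (f' := fun _ => 0) (a := 0) (b := 1) (B := fun t => ψ (1 - t)) (B' := fun t => -ψ' (1 - t))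
      continuousOn_const (fun t _ => hasDerivWithinAt_const _ _ _) (by simpa [hψ] using hle₁)
      (fun t => by
        have := (hder (1 - t)).comp t ((hasDerivAt_id t).const_sub 1)
        rw [mul_neg, mul_one] at this
        exact this)
      (fun t ht h => by
        obtain ⟨X, hX, e⟩ := hcross (1 - t) ⟨by linarith [ht.2], by linarith [ht.1]⟩ h.symm
        rw [e]; linarith [hs X hX])
    have := hmain (x := 1 - t) ⟨by linarith [ht.2], by linarith [ht.1]⟩
    simpa using this

end Line

/-! ### Supporting hyperboloids of a refractor and the neighborhood inclusion. -/

section Refractor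

variable {n : ℕ} {κ τ₀ τ₁ ω : ℝ} {Ω : Set (Base n)} {T : Set (Space n)} {u : Base n → ℝ}

lemma mem_sourceCylinder (hu : IsRefractor κ Ω T u) (hτ : ∀ x ∈ Ω, u x ≤ τ₀) {x : Base n}
    (hx : x ∈ Ω) : pt x (u x) ∈ sourceCylinder Ω τ₀ :=
  ⟨hx, (hu.1 x hx).le, hτ x hx⟩

lemma IsRefractor.normalMap_nonempty (hu : IsRefractor κ Ω T u) (hκ : 1 < κ) {x : Base n}
    (hx : x ∈ Ω) : (normalMap κ Ω T u x).Nonempty := by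
  obtain ⟨Y, hY, b, hb, -, hle, heq⟩ := hu.2 x hx
  exact ⟨Y, hY, fun x' hx' => by rw [heq, phi_pt_hyperboloid hκ Y hb.le]; exact hle x' hx'⟩

lemma phi_at_base (hκ : 1 < κ) (Y : Space n) (x : Base n) (h : ℝ) : phi κ x Y (pt x h) = h :=
  phi_self hκ (pt x h) Y

lemma Configuration.refractor_lipschitz (hC : Configuration κ Ω T τ₀ τ₁ ω)
    (hu : IsRefractor κ Ω T u) (hτ : ∀ x ∈ Ω, u x ≤ τ₀) {x x' : Base n} (hx : x ∈ Ω)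
    (hx' : x' ∈ Ω) : |u x - u x'| ≤ (Real.sqrt (κ ^ 2 - 1))⁻¹ * ‖x - x'‖ := by
  have hκ := hC.one_lt_kappa
  have key : ∀ x ∈ Ω, ∀ x' ∈ Ω, u x - u x' ≤ (Real.sqrt (κ ^ 2 - 1))⁻¹ * ‖x - x'‖ := by
    intro x hx x' hx'
    obtain ⟨Y, hY, hle⟩ := hu.normalMap_nonempty hκ hx
    have hc := hC.cFun_pos (mem_sourceCylinder hu hτ hx) hY
    have h1 := abs_phi_sub_snd_le hκ hc x'
    rw [pt_snd, pt_fst] at h1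
    have h2 := (abs_le.1 h1).1
    rw [norm_sub_rev] at h2
    linarith [hle x' hx']
  rw [abs_le]
  have := key x' hx' x hx
  rw [norm_sub_rev] at this
  exact ⟨by linarith, key x hx x' hx'⟩

lemma Configuration.refractor_continuousOn (hC : Configuration κ Ω T τ₀ τ₁ ω)
    (hu : IsRefractor κ Ω T u) (hτ : ∀ x ∈ Ω, u x ≤ τ₀) : ContinuousOn u Ω := by
  have hk := kappa_sq_sub_one_pos hC.one_lt_kappa
  refine LipschitzOnWith.continuousOn (K := (Real.sqrt (κ ^ 2 - 1))⁻¹.toNNReal)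
    (LipschitzOnWith.of_dist_le_mul fun x hx x' hx' => ?_)
  rw [Real.coe_toNNReal _ (by positivity), Real.dist_eq, dist_eq_norm]
  exact hC.refractor_lipschitz hu hτ hx hx'

/-- A hyperboloid that lies below the graph outside a ball touches it over the ball after a
change of its parameter. -/
lemma Configuration.exists_mem_normalMap (hC : Configuration κ Ω T τ₀ τ₁ ω)
    (hu : IsRefractor κ Ω T u) (hτ : ∀ x ∈ Ω, u x ≤ τ₀) {x₀ : Base n} {η : ℝ} (hη : 0 < η)
    (hball : Metric.closedBall x₀ η ⊆ Ω) {Y : Space n} (hY : Y ∈ T)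
    (hout : ∀ x ∈ Ω, η ≤ ‖x - x₀‖ → phi κ x Y (pt x₀ (u x₀)) ≤ u x) :
    ∃ x ∈ Metric.ball x₀ η, Y ∈ normalMap κ Ω T u x := by
  have hκ := hC.one_lt_kappa
  set G : Base n → ℝ := fun x => cFun κ (pt x (u x)) Y with hG
  have hx₀ : x₀ ∈ Ω := hball (Metric.mem_closedBall_self hη.le)
  have hpos : ∀ x ∈ Ω, 0 < G x := fun x hx => hC.cFun_pos (mem_sourceCylinder hu hτ hx) hY
  have hle : ∀ x' ∈ Ω, ∀ x, phi κ x Y (pt x' (u x')) ≤ u x ↔ G x ≤ G x' := fun x' hx' x =>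
    hyperboloid_le_iff hκ Y (hpos x' hx').le x (u x)
  have hGc : ContinuousOn G (Metric.closedBall x₀ η) := by
    have hc := (hC.refractor_continuousOn hu hτ).mono hball
    have h1 : Continuous fun p : Base n × ℝ => cFun κ (pt p.1 p.2) Y := by
      unfold cFun
      have : Continuous fun p : Base n × ℝ => (pt p.1 p.2 : Space n) :=
        (WithLp.prod_continuous_toLp 2 (Base n) ℝ)
      simp only [pt_snd]
      fun_prop
    exact h1.comp_continuousOn (continuousOn_id.prodMk hc)
  obtain ⟨x₁, hx₁, hmax⟩ := (isCompact_closedBall x₀ η).exists_isMaxOn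
    ⟨x₀, Metric.mem_closedBall_self hη.le⟩ hGc
  have hfar : ∀ x ∈ Ω, η ≤ ‖x - x₀‖ → G x ≤ G x₀ := fun x hx h => (hle x₀ hx₀ x).1 (hout x hx h)
  have hmax' : ∀ x ∈ Ω, G x ≤ G x₁ := fun x hx => by
    rcases le_total η ‖x - x₀‖ with h | h
    · exact (hfar x hx h).trans (hmax (Metric.mem_closedBall_self hη.le))
    · exact hmax (mem_closedBall_iff_norm.2 h)
  -- Maximizers of G over Ω are exactly the contact points for focus Y. If the maximum sits on the
  -- sphere, then G(x₁) ≤ G(x₀) by `hfar`, and the center is a maximizer too.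
  rcases lt_or_ge ‖x₁ - x₀‖ η with h | h
  · exact ⟨x₁, mem_ball_iff_norm.2 h, hY, fun x hx => (hle x₁ (hball hx₁) x).2 (hmax' x hx)⟩
  · exact ⟨x₀, Metric.mem_ball_self hη, hY, fun x hx =>
      (hle x₀ hx₀ x).2 ((hmax' x hx).trans (hfar x₁ (hball hx₁) h))⟩

/-- The Lipschitz constant of the slope with respect to the focus. -/
noncomputable def slopeLip (κ b₀ : ℝ) : ℝ := b₀⁻¹ * (2 + (Real.sqrt (κ ^ 2 - 1))⁻¹) * (κ + 2)

lemma slopeLip_pos (hκ : 1 < κ) {b₀ : ℝ} (hb₀ : 0 < b₀) : 0 < slopeLip κ b₀ := by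
  have hk := kappa_sq_sub_one_pos hκ
  have : 0 < κ + 2 := by linarith
  unfold slopeLip
  positivity

lemma norm_hypSlope_sub_focus_le (hκ : 1 < κ) {Z Y Y' : Space n} {b₀ : ℝ} (hb₀ : 0 < b₀)
    (hY : b₀ ≤ cFun κ Z Y) (hY' : b₀ ≤ cFun κ Z Y') (x : Base n) :
    ‖hypSlope κ Y (cFun κ Z Y) x - hypSlope κ Y' (cFun κ Z Y') x‖
      ≤ slopeLip κ b₀ * ‖Y - Y'‖ := by
  have hk := kappa_sq_sub_one_pos hκ
  refine (norm_hypSlope_sub_le hκ Y Y' hb₀ hY hY' x x).trans ?_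
  have h1 := abs_cFun_sub_le hκ Z Z Y Y'
  rw [sub_self, norm_zero, zero_add] at h1
  have h2 := space_norm_fst_le (Y - Y')
  rw [WithLp.sub_fst] at h2
  rw [sub_sub_sub_cancel_right, slopeLip, mul_assoc _ (κ + 2)]
  gcongr
  linarith

/-- The difference vanishes at the base point of Z, and its gradient is bounded by the Lipschitz
dependence of the slope on the focus. -/
lemma abs_phi_sub_phi_le (hκ : 1 < κ) {Z Y Y' : Space n} {b₀ : ℝ} (hb₀ : 0 < b₀)
    (hY : b₀ ≤ cFun κ Z Y) (hY' : b₀ ≤ cFun κ Z Y') (x : Base n) :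
    |phi κ x Y Z - phi κ x Y' Z| ≤ slopeLip κ b₀ * ‖Y - Y'‖ * ‖x - Z.fst‖ := by
  have hder : ∀ x' ∈ (univ : Set (Base n)), HasFDerivWithinAt (fun x => phi κ x Y Z - phi κ x Y' Z)
      (InnerProductSpace.toDual ℝ (Base n) (hypSlope κ Y (cFun κ Z Y) x') -
        InnerProductSpace.toDual ℝ (Base n) (hypSlope κ Y' (cFun κ Z Y') x')) univ x' :=
    fun x' _ => ((hasGradientAt_hyperboloid hκ Y (hb₀.trans_le hY) x').hasFDerivAt.sub
      (hasGradientAt_hyperboloid hκ Y' (hb₀.trans_le hY') x').hasFDerivAt).hasFDerivWithinAt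
  have h := convex_univ.norm_image_sub_le_of_norm_hasFDerivWithin_le
    (C := slopeLip κ b₀ * ‖Y - Y'‖) hder (fun x' _ => by
      rw [← map_sub, LinearIsometryEquiv.norm_map]
      exact norm_hypSlope_sub_focus_le hκ hb₀ hY hY' x') (mem_univ Z.fst) (mem_univ x)
  simpa [phi_self hκ] using h

lemma phi_height_le (hκ : 1 < κ) (Y : Space n) (x z : Base n) (h h' : ℝ) :
    phi κ x Y (pt z h') ≤ phi κ x Y (pt z h) + (κ + 1) ^ 2 / (κ ^ 2 - 1) * |h' - h| := by
  have hk := kappa_sq_sub_one_pos hκ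
  have h1 := abs_hyperboloid_sub_param_le hκ Y (cFun κ (pt z h') Y) (cFun κ (pt z h) Y) x
  have h2 := abs_cFun_sub_le hκ (pt z h') (pt z h) Y Y
  have h3 : ‖(pt z h' : Space n) - pt z h‖ ≤ |h' - h| := by
    refine (norm_le_fst_add_snd _).trans ?_
    rw [WithLp.sub_fst, WithLp.sub_snd, pt_fst, pt_fst, pt_snd, pt_snd, sub_self, norm_zero,
      zero_add]
  rw [sub_self, norm_zero, add_zero] at h2
  have h4 : (κ + 1) / (κ ^ 2 - 1) * |cFun κ (pt z h') Y - cFun κ (pt z h) Y| ≤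
      (κ + 1) / (κ ^ 2 - 1) * ((κ + 1) * |h' - h|) := by
    gcongr
    exact h2.trans (by gcongr)
  have h5 := (le_abs_self _).trans (h1.trans h4)
  have h6 : (κ + 1) / (κ ^ 2 - 1) * ((κ + 1) * |h' - h|) =
    (κ + 1) ^ 2 / (κ ^ 2 - 1) * |h' - h| := by ring
  rw [h6] at h5
  unfold phi
  linarith

/-- The height of the refractor above the common point of two of its supporting hyperboloids. -/
lemma Configuration.refractor_sub_le (hC : Configuration κ Ω T τ₀ τ₁ ω)
    (hu : IsRefractor κ Ω T u) (hτ : ∀ x ∈ Ω, u x ≤ τ₀) {b₀ : ℝ} (hb₀ : 0 < b₀)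
    (hb : ∀ X ∈ sourceCylinder Ω τ₀, ∀ Y ∈ T, b₀ ≤ cFun κ X Y) {Z : Space n}
    (hZ : Z ∈ sourceCylinder Ω τ₀) {Y₁ Y₂ : Space n} (hY₁ : Y₁ ∈ T) (hY₂ : Y₂ ∈ T)
    {x₁ x₂ : Base n} (hx₁ : x₁ ∈ Ω) (hx₂ : x₂ ∈ Ω) {t : ℝ} (ht : t ∈ Icc (0 : ℝ) 1)
    (hz : Z.fst = x₁ + t • (x₂ - x₁)) (h₁ : u x₁ = phi κ x₁ Y₁ Z) (h₂ : u x₂ = phi κ x₂ Y₂ Z)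
    (hle : ‖x₁ - x₂‖ ≤ ‖Y₁ - Y₂‖) :
    u Z.fst - Z.snd ≤ (slopeLip κ b₀ + (2 * b₀)⁻¹) * (‖Y₁ - Y₂‖ * ‖x₁ - x₂‖) := by
  have hκ := hC.one_lt_kappa
  obtain ⟨Y, hY, hsup⟩ := hu.normalMap_nonempty hκ hZ.1
  have hX := mem_sourceCylinder hu hτ hZ.1
  have hc := hC.cFun_pos hX hY
  have hcb := hb _ hX Y hY
  have s₁ := (tangent_sub_le_hyperboloid hκ Y hc Z.fst x₁).trans (hsup x₁ hx₁)
  have s₂ := (tangent_sub_le_hyperboloid hκ Y hc Z.fst x₂).trans (hsup x₂ hx₂)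
  have hbase : hyperboloid κ Y (cFun κ (pt Z.fst (u Z.fst)) Y) Z.fst = u Z.fst :=
    phi_at_base hκ Y Z.fst (u Z.fst)
  rw [hbase] at s₁ s₂
  have t₁ := hyperboloid_le_tangent hκ Y₁ (hC.cFun_pos hZ hY₁) Z.fst x₁
  have t₂ := hyperboloid_le_tangent hκ Y₂ (hC.cFun_pos hZ hY₂) Z.fst x₂
  rw [hyperboloid_cFun hκ] at t₁ t₂
  rw [phi] at h₁ h₂
  rw [← h₁] at t₁
  rw [← h₂] at t₂
  have d₁ : x₁ - Z.fst = (-t) • (x₂ - x₁) := by rw [hz]; module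
  have d₂ : x₂ - Z.fst = (1 - t) • (x₂ - x₁) := by rw [hz]; module
  have ht' : 0 ≤ 1 - t := sub_nonneg.2 ht.2
  have n₁ : ‖x₁ - Z.fst‖ ≤ ‖x₁ - x₂‖ := by
    rw [d₁, norm_smul, norm_neg, Real.norm_eq_abs, abs_of_nonneg ht.1, norm_sub_rev x₁]
    exact mul_le_of_le_one_left (norm_nonneg _) ht.2
  have n₂ : ‖x₂ - Z.fst‖ ≤ ‖x₁ - x₂‖ := by
    rw [d₂, norm_smul, Real.norm_eq_abs, abs_of_nonneg ht', norm_sub_rev x₁]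
    exact mul_le_of_le_one_left (norm_nonneg _) (by linarith [ht.1])
  have q : ∀ x, ‖x - Z.fst‖ ≤ ‖x₁ - x₂‖ →
      (2 * cFun κ (pt Z.fst (u Z.fst)) Y)⁻¹ * ‖x - Z.fst‖ ^ 2 ≤
        (2 * b₀)⁻¹ * (‖Y₁ - Y₂‖ * ‖x₁ - x₂‖) := fun x hx => by
    rw [sq]
    gcongr
    exact hx.trans hle
  have q₁ := q x₁ n₁
  have q₂ := q x₂ n₂
  rw [d₁, real_inner_smul_right] at s₁ t₁
  rw [d₂, real_inner_smul_right] at s₂ t₂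
  rw [← d₁] at s₁
  rw [← d₂] at s₂
  set R := (2 * b₀)⁻¹ * (‖Y₁ - Y₂‖ * ‖x₁ - x₂‖)
  set p := inner ℝ (hypSlope κ Y (cFun κ (pt Z.fst (u Z.fst)) Y) Z.fst) (x₂ - x₁)
  set p₁ := inner ℝ (hypSlope κ Y₁ (cFun κ Z Y₁) Z.fst) (x₂ - x₁) with hp₁
  set p₂ := inner ℝ (hypSlope κ Y₂ (cFun κ Z Y₂) Z.fst) (x₂ - x₁) with hp₂
  -- The support at the graph point over z bounds u(xᵢ) from below, up to a quadratic error; the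
  -- tangent plane of φ(·, Yᵢ, Z) bounds it from above.
  have f₁ : u Z.fst - Z.snd ≤ t * (p - p₁) + R := by linarith
  have f₂ : u Z.fst - Z.snd ≤ (1 - t) * (p₂ - p) + R := by linarith
  -- The weights 1 - t and t eliminate the uncontrolled slope p.
  have f : u Z.fst - Z.snd ≤ (1 - t) * t * (p₂ - p₁) + R := by
    linarith [mul_le_mul_of_nonneg_left f₁ ht', mul_le_mul_of_nonneg_left f₂ ht.1]
  have g : |p₂ - p₁| ≤ slopeLip κ b₀ * (‖Y₁ - Y₂‖ * ‖x₁ - x₂‖) := by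
    rw [hp₁, hp₂, ← inner_sub_left]
    refine (abs_real_inner_le_norm _ _).trans ?_
    rw [norm_sub_rev x₂, ← mul_assoc, norm_sub_rev Y₁]
    gcongr
    exact norm_hypSlope_sub_focus_le hκ hb₀ (hb Z hZ Y₂ hY₂) (hb Z hZ Y₁ hY₁) _
  have g' : (1 - t) * t * (p₂ - p₁) ≤ |p₂ - p₁| := by
    have h1 : (1 - t) * t ≤ 1 := by nlinarith [ht.1, ht.2]
    have h2 : 0 ≤ (1 - t) * t := mul_nonneg ht' ht.1
    calc _ ≤ (1 - t) * t * |p₂ - p₁| := by gcongr; exact le_abs_self _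
      _ ≤ _ := mul_le_of_le_one_left (abs_nonneg _) h1
  rw [add_mul]
  linarith

lemma globalConst_mul (b₀ D A c : ℝ) :
    globalConst κ b₀ D (A * c) = globalConst κ b₀ D A * c := by
  unfold globalConst; ring

lemma globalConst_pos (hκ : 1 < κ) {b₀ D A : ℝ} (hb₀ : 0 < b₀) (hD : 0 ≤ D) (hA : 0 < A) :
    0 < globalConst κ b₀ D A := by
  have hk := kappa_sq_sub_one_pos hκ
  have h1 : 0 < b₀ ^ 2 / (κ ^ 2 - 1) := by positivity
  have h2 : D ^ 2 / (b₀ ^ 2 / (κ ^ 2 - 1) + D ^ 2) < 1 := by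
    rw [div_lt_one (by positivity)]; linarith
  have h3 := sub_pos.2 h2
  unfold globalConst
  positivity

lemma globalConst_le (hκ : 1 < κ) {b₀ D A : ℝ} (hb₀ : 0 < b₀) (hD : 0 ≤ D) (hA : 0 < A) :
    globalConst κ b₀ D A ≤ A := by
  have hk := kappa_sq_sub_one_pos hκ
  have h2 : 0 ≤ D ^ 2 / (b₀ ^ 2 / (κ ^ 2 - 1) + D ^ 2) := by positivity
  have h3 : 0 ≤ (Real.sqrt (κ ^ 2 - 1))⁻¹ * (2 * D) / (b₀ / (κ ^ 2 - 1)) := by positivity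
  unfold globalConst
  rw [div_le_iff₀ (by positivity)]
  nlinarith [mul_nonneg hA.le h3, mul_nonneg hA.le h2]

/-- Target points near the middle of a refractor segment are attained by the normal map near the
common point of the two supporting hyperboloids. -/
lemma Configuration.thickening_subset (hC : Configuration κ Ω T τ₀ τ₁ ω) (hn : 1 ≤ n)
    (hu : IsRefractor κ Ω T u) (hτ : ∀ x ∈ Ω, u x ≤ τ₀) {b₀ : ℝ} (hb₀ : 0 < b₀)
    (hb : ∀ X ∈ sourceCylinder Ω τ₀, ∀ Y ∈ T, b₀ ≤ cFun κ X Y) {Z : Space n}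
    (hZ : Z ∈ sourceCylinder Ω τ₀) {Y₁ Y₂ : Space n} (hY₁ : Y₁ ∈ T) (hY₂ : Y₂ ∈ T)
    (hne : Y₁ ≠ Y₂) {A C₂ : ℝ} (hA : 0 < A) (hC₂ : 0 < C₂)
    (hreg : ∀ x ∈ Ω, ‖x - Z.fst‖ ≤ C₂ → ∀ Y ∈ middleSegment κ T Z Y₁ Y₂,
      phi κ x Y Z ≤ max (phi κ x Y₁ Z) (phi κ x Y₂ Z) - A * ‖Y₁ - Y₂‖ ^ 2 * ‖x - Z.fst‖ ^ 2)
    (hs₁ : ∀ x ∈ Ω, phi κ x Y₁ Z ≤ u x) (hs₂ : ∀ x ∈ Ω, phi κ x Y₂ Z ≤ u x)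
    {η μ : ℝ} (hη : 0 < η) (hηC : η ≤ C₂) (hball : Metric.closedBall Z.fst η ⊆ Ω)
    (hμ : 2 * slopeLip κ b₀ * μ ≤ globalConst κ b₀ (bigDelta Ω T) A * ‖Y₁ - Y₂‖ ^ 2 * η)
    (hgap : 2 * ((κ + 1) ^ 2 / (κ ^ 2 - 1) * (u Z.fst - Z.snd)) <
      globalConst κ b₀ (bigDelta Ω T) A * ‖Y₁ - Y₂‖ ^ 2 * η ^ 2) :
    Metric.thickening μ (middleSegment κ T Z Y₁ Y₂) ∩ T ⊆
      ⋃ x ∈ Metric.ball Z.fst η, normalMap κ Ω T u x := by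
  rintro Y' ⟨hY'μ, hY'⟩
  obtain ⟨Y, ⟨l, hl, hYl⟩, hYY'⟩ := Metric.mem_thickening_iff.1 hY'μ
  have hκ := hC.one_lt_kappa
  have hY : Y ∈ T := hYl.1
  have hL := slopeLip_pos hκ hb₀
  have hD : 0 ≤ bigDelta Ω T := (norm_nonneg _).trans (hC.norm_sub_le_bigDelta hZ.1 hY)
  have hA'pos := globalConst_pos hκ hb₀ hD hA
  have hA'le := globalConst_le hκ hb₀ hD hA
  set A' := globalConst κ b₀ (bigDelta Ω T) A with hA'
  have hdY : 0 < ‖Y₁ - Y₂‖ := norm_pos_iff.2 (sub_ne_zero.2 hne)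
  -- The gain A' s² |x - z|² is split in two halves. One absorbs the change of focus, which is
  -- linear in |x - z| ≥ η; the other absorbs the change of height.
  have hnear : ∀ x, η ≤ ‖x - Z.fst‖ → phi κ x Y Z ≤ max (phi κ x Y₁ Z) (phi κ x Y₂ Z)
      - A' * ‖Y₁ - Y₂‖ ^ 2 * ‖x - Z.fst‖ ^ 2 →
      phi κ x Y' (pt Z.fst (u Z.fst)) < max (phi κ x Y₁ Z) (phi κ x Y₂ Z) := by
    intro x hx hm
    have h1 := (le_abs_self _).trans (abs_phi_sub_phi_le hκ hb₀ (hb Z hZ Y' hY') (hb Z hZ Y hY) x)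
    have h2 := phi_height_le hκ Y' x Z.fst Z.snd (u Z.fst)
    have hZu : Z.snd ≤ u Z.fst := by
      have := hs₁ Z.fst hZ.1
      rwa [phi_self hκ] at this
    rw [abs_of_nonneg (sub_nonneg.2 hZu), show (pt Z.fst Z.snd : Space n) = Z from rfl] at h2
    have h3 : ‖Y' - Y‖ ≤ μ := by rw [← dist_eq_norm]; exact hYY'.le
    have h4 : slopeLip κ b₀ * ‖Y' - Y‖ * ‖x - Z.fst‖ ≤ slopeLip κ b₀ * μ * ‖x - Z.fst‖ := by
      gcongr
    have h5 : 2 * slopeLip κ b₀ * μ * ‖x - Z.fst‖ ≤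
        A' * ‖Y₁ - Y₂‖ ^ 2 * ‖x - Z.fst‖ ^ 2 := by
      calc _ ≤ A' * ‖Y₁ - Y₂‖ ^ 2 * η * ‖x - Z.fst‖ := by gcongr
        _ ≤ A' * ‖Y₁ - Y₂‖ ^ 2 * ‖x - Z.fst‖ * ‖x - Z.fst‖ := by gcongr
        _ = _ := by ring
    have h6 : A' * ‖Y₁ - Y₂‖ ^ 2 * η ^ 2 ≤ A' * ‖Y₁ - Y₂‖ ^ 2 * ‖x - Z.fst‖ ^ 2 := by gcongr
    linarith
  have hnear' : ∀ x ∈ Ω, η ≤ ‖x - Z.fst‖ → ‖x - Z.fst‖ ≤ C₂ →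
      phi κ x Y' (pt Z.fst (u Z.fst)) < max (phi κ x Y₁ Z) (phi κ x Y₂ Z) := by
    intro x hx hxη hxC
    refine hnear x hxη ((hreg x hx hxC Y ⟨l, hl, hYl⟩).trans ?_)
    gcongr
  have hl' : l ∈ Icc (0 : ℝ) 1 := ⟨by linarith [hl.1], by linarith [hl.2]⟩
  have hX := mem_sourceCylinder hu hτ hZ.1
  suffices h : ∀ x ∈ Ω, η ≤ ‖x - Z.fst‖ → phi κ x Y' (pt Z.fst (u Z.fst)) ≤ u x by
    obtain ⟨x, hx, hxY⟩ := hC.exists_mem_normalMap hu hτ hη hball hY' h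
    exact mem_iUnion₂.2 ⟨x, hx, hxY⟩
  intro x hx hxη
  rcases hn.eq_or_lt with hn1 | hn2
  -- If the new hyperboloid exceeded u at x, it would dominate both supports at z and at x, hence in
  -- between. That contradicts the strict local comparison at distance exactly η from z.
  · by_contra! hcon
    have hw : 0 < ‖x - Z.fst‖ := hη.trans_le hxη
    set t := η / ‖x - Z.fst‖ with ht
    have ht01 : t ∈ Icc (0 : ℝ) 1 := ⟨by positivity, (div_le_one hw).2 hxη⟩
    have hy : ‖Z.fst + t • (x - Z.fst) - Z.fst‖ = η := by
      rw [add_sub_cancel_left, norm_smul, Real.norm_eq_abs, abs_of_nonneg ht01.1,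
        div_mul_cancel₀ _ hw.ne']
    have hyΩ : Z.fst + t • (x - Z.fst) ∈ Ω := hball (mem_closedBall_iff_norm.2 hy.le)
    have hlt := hnear' _ hyΩ hy.ge (by rw [hy]; exact hηC)
    have hbase : hyperboloid κ Y' (cFun κ (pt Z.fst (u Z.fst)) Y') Z.fst = u Z.fst :=
      phi_at_base hκ Y' Z.fst (u Z.fst)
    have hxe : Z.fst + (x - Z.fst) = x := by abel
    have one : ∀ Y₃ ∈ T, (∀ x ∈ Ω, phi κ x Y₃ Z ≤ u x) →
        ¬ phi κ (Z.fst + t • (x - Z.fst)) Y' (pt Z.fst (u Z.fst)) <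
          phi κ (Z.fst + t • (x - Z.fst)) Y₃ Z := by
      intro Y₃ hY₃ hs
      refine not_lt.2 (hC.hyperboloid_le_on_segment hn1.symm hY' hY₃ (hC.cFun_pos hX hY')
        (hC.cFun_pos hZ hY₃) hZ.1 (by rwa [hxe]) (fun x hx => (hs x hx).trans (hτ x hx))
        ?_ ?_ ?_ ?_ ht01)
      · rw [hbase]; exact (hu.1 _ hZ.1).le
      · rw [hxe]; exact (hu.1 x hx).le.trans hcon.le
      · rw [hbase]; exact hs _ hZ.1
      · rw [hxe]; exact (hs x hx).trans hcon.le
    rcases lt_max_iff.1 hlt with h | h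
    · exact one Y₁ hY₁ hs₁ h
    · exact one Y₂ hY₂ hs₂ h
  · refine (hnear x hxη ?_).le.trans (max_le (hs₁ x hx) (hs₂ x hx))
    rw [hA', ← globalConst_mul]
    exact hC.regular_global hn2 hZ hY₁ hY₂ hY hne hl'
      (hC.slope_of_isSegmentPoint hZ hY₁ hY₂ hl' hYl) hb₀ (hb Z hZ) (by positivity) hC₂
      (fun x hx hxC => hreg x hx hxC Y ⟨l, hl, hYl⟩) hx

end Refractor

/-! ### Comparison of the two measure bounds at scale η. -/

section Growth

variable {n : ℕ} {κ τ₀ τ₁ ω : ℝ} {Ω : Set (Base n)} {T : Set (Space n)} {u : Base n → ℝ}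

/-- Two supporting hyperboloids meet over the segment between their contact points, at a point
of the cylinder close to the graph. -/
lemma Configuration.exists_common_point (hC : Configuration κ Ω T τ₀ τ₁ ω)
    (hu : IsRefractor κ Ω T u) (hτ : ∀ x ∈ Ω, u x ≤ τ₀) {x₁ x₂ : Base n} (hx₁ : x₁ ∈ Ω)
    (hx₂ : x₂ ∈ Ω) {Y₁ Y₂ : Space n} (hY₁ : Y₁ ∈ normalMap κ Ω T u x₁)
    (hY₂ : Y₂ ∈ normalMap κ Ω T u x₂) :
    ∃ t ∈ Icc (0 : ℝ) 1, ∃ e : ℝ,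
      |e - u x₁| ≤ (Real.sqrt (κ ^ 2 - 1))⁻¹ * ‖x₁ - x₂‖ ∧ e ≤ τ₀ ∧
      (∀ x, phi κ x Y₁ (pt (x₁ + t • (x₂ - x₁)) e) = phi κ x Y₁ (pt x₁ (u x₁))) ∧
      ∀ x, phi κ x Y₂ (pt (x₁ + t • (x₂ - x₁)) e) = phi κ x Y₂ (pt x₂ (u x₂)) := by
  have hκ := hC.one_lt_kappa
  have hk := kappa_sq_sub_one_pos hκ
  have hc₁ := hC.cFun_pos (mem_sourceCylinder hu hτ hx₁) hY₁.1
  have hc₂ := hC.cFun_pos (mem_sourceCylinder hu hτ hx₂) hY₂.1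
  have hcont₁ := continuous_phi hκ hc₁
  have hcont₂ := continuous_phi hκ hc₂
  set ψ : ℝ → ℝ := fun t => phi κ (x₁ + t • (x₂ - x₁)) Y₁ (pt x₁ (u x₁))
    - phi κ (x₁ + t • (x₂ - x₁)) Y₂ (pt x₂ (u x₂)) with hψ
  have hψc : Continuous ψ := by
    have hl : Continuous fun t : ℝ => x₁ + t • (x₂ - x₁) := by fun_prop
    exact (hcont₁.comp hl).sub (hcont₂.comp hl)
  have h0 : 0 ≤ ψ 0 := by
    simp only [hψ, zero_smul, add_zero, phi_at_base hκ]
    exact sub_nonneg.2 (hY₂.2 x₁ hx₁)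
  have h1 : ψ 1 ≤ 0 := by
    simp only [hψ, one_smul, add_sub_cancel, phi_at_base hκ]
    exact sub_nonpos.2 (hY₁.2 x₂ hx₂)
  obtain ⟨t, ht, hψt⟩ := intermediate_value_Icc' zero_le_one hψc.continuousOn ⟨h1, h0⟩
  have hmem : x₁ + t • (x₂ - x₁) ∈ Ω := by
    have := hC.source_convex hx₁ hx₂ (sub_nonneg.2 ht.2) ht.1 (sub_add_cancel 1 t)
    rwa [show (1 - t) • x₁ + t • x₂ = x₁ + t • (x₂ - x₁) by module] at this
  refine ⟨t, ht, phi κ (x₁ + t • (x₂ - x₁)) Y₁ (pt x₁ (u x₁)), ?_, ?_, ?_, ?_⟩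
  · have h := abs_phi_sub_snd_le hκ hc₁ (x₁ + t • (x₂ - x₁))
    refine h.trans ?_
    rw [pt_fst, add_sub_cancel_left, norm_smul, Real.norm_eq_abs, abs_of_nonneg ht.1,
      norm_sub_rev x₂]
    gcongr
    exact mul_le_of_le_one_left (norm_nonneg _) ht.2
  · exact (hY₁.2 _ hmem).trans (hτ _ hmem)
  · exact fun x => phi_pt_hyperboloid hκ Y₁ hc₁.le x _
  · intro x
    rw [sub_eq_zero.1 hψt]
    exact phi_pt_hyperboloid hκ Y₂ hc₂.le x _

/-- The comparison of the two assumptions on the measure, at every admissible scale `η`. -/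
lemma Configuration.exists_growth_inequality (hC : Configuration κ Ω T τ₀ τ₁ ω) (hn : 1 ≤ n)
    {Xs : Space n} (hXs : Xs ∈ sourceCylinder Ω τ₀) (hpos : 0 < Xs.snd)
    (hreg : RegularFrom κ Ω T τ₀ Xs) {U : Set (Space n)} (hU : U ∈ 𝓝 Xs) {μ₀ : ℝ}
    (hμ₀ : 0 < μ₀) :
    ∃ δ > 0, ∃ M > 0, ∃ C₂ > 0, Metric.ball Xs.fst δ ⊆ Ω ∧
      ∀ u : Base n → ℝ, IsRefractor κ Ω T u → (∀ x ∈ Ω, u x ≤ τ₀) → u Xs.fst = Xs.snd →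
      ∀ (σ : Measure (Space n)) (q C₀ Ct : ℝ), 0 < C₀ → 0 < Ct →
        LocalLowerBound κ Ω T τ₀ U μ₀ Ct σ → GrowthBound κ Ω T u q C₀ σ →
        ∀ x₁ ∈ Metric.ball Xs.fst (δ / 2), ∀ x₂ ∈ Metric.ball Xs.fst (δ / 2),
          ∀ Y₁ ∈ normalMap κ Ω T u x₁, ∀ Y₂ ∈ normalMap κ Ω T u x₂, Y₁ ≠ Y₂ →
            ‖x₁ - x₂‖ ≤ ‖Y₁ - Y₂‖ → ∀ η : ℝ, 0 < η → η ≤ δ / 2 → η ≤ C₂ →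
              M ^ 2 * ‖x₁ - x₂‖ ≤ η ^ 2 * ‖Y₁ - Y₂‖ →
              Ct * (η * ‖Y₁ - Y₂‖ ^ 2 / M) ^ (n - 1) * ‖Y₁ - Y₂‖ ≤
                C₀ * η ^ ((n : ℝ) / q) := by
  have hκ := hC.one_lt_kappa
  have hk := kappa_sq_sub_one_pos hκ
  obtain ⟨V, hV, A, hA, C₂, hC₂, hregV⟩ := hreg
  obtain ⟨b₀, hb₀, hb⟩ : ∃ b₀ > 0, ∀ X ∈ sourceCylinder Ω τ₀, ∀ Y ∈ T, b₀ ≤ cFun κ X Y :=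
    ⟨_, hC.lower_pos, fun X hX Y hY => hC.cFun_lower hX hY⟩
  set ℓ := (Real.sqrt (κ ^ 2 - 1))⁻¹ with hℓ
  have hℓ0 : 0 < ℓ := inv_pos.2 (Real.sqrt_pos.2 hk)
  have hL := slopeLip_pos hκ hb₀
  obtain ⟨ε, hε, hεUV⟩ := Metric.mem_nhds_iff.1 (Filter.inter_mem hU hV)
  obtain ⟨r₀, hr₀, hball₀⟩ := Metric.isOpen_iff.1 hC.source_open Xs.fst hXs.1
  -- The second bound keeps the crossing point Z in U ∩ V; the third keeps its height positive, so
  -- that Z lies in the cylinder.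
  obtain ⟨δ, hδ, hδr, hδε, hδh⟩ : ∃ δ > 0, δ ≤ r₀ ∧ (1 + 2 * ℓ) * δ < ε ∧ 2 * ℓ * δ < Xs.snd := by
    refine ⟨min r₀ (min (ε / (2 * (1 + 2 * ℓ))) (Xs.snd / (4 * ℓ))), by positivity,
      min_le_left _ _, ?_, ?_⟩
    · have h : min r₀ (min (ε / (2 * (1 + 2 * ℓ))) (Xs.snd / (4 * ℓ))) ≤ ε / (2 * (1 + 2 * ℓ)) :=
        (min_le_right _ _).trans (min_le_left _ _)
      rw [le_div_iff₀ (by positivity)] at h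
      linarith
    · have h : min r₀ (min (ε / (2 * (1 + 2 * ℓ))) (Xs.snd / (4 * ℓ))) ≤ Xs.snd / (4 * ℓ) :=
        (min_le_right _ _).trans (min_le_right _ _)
      rw [le_div_iff₀ (by positivity)] at h
      linarith
  have hball : Metric.ball Xs.fst δ ⊆ Ω := (Metric.ball_subset_ball hδr).trans hball₀
  rcases T.eq_empty_or_nonempty with hT | ⟨Y₀, hY₀⟩
  · refine ⟨δ, hδ, 1, one_pos, 1, one_pos, hball, ?_⟩
    intro u _ _ _ σ q C₀ Ct _ _ _ _ x₁ _ x₂ _ Y₁ hY₁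
    exact absurd hY₁.1 (by rw [hT]; exact notMem_empty _)
  have hD : 0 ≤ bigDelta Ω T := (norm_nonneg _).trans (hC.norm_sub_le_bigDelta hXs.1 hY₀)
  set A' := globalConst κ b₀ (bigDelta Ω T) A with hA'
  have hA'pos : 0 < A' := globalConst_pos hκ hb₀ hD hA
  set H := (κ + 1) ^ 2 / (κ ^ 2 - 1) * (slopeLip κ b₀ + (2 * b₀)⁻¹) with hH
  have hH0 : 0 < H := by positivity
  -- The requirements on M pay for the change of focus, for the change of height (4H rather than 2H,
  -- to leave a strict inequality) and for μ < μ₀.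
  obtain ⟨M, hM1, hML, hMH, hMμ⟩ : ∃ M : ℝ, 1 ≤ M ∧ 2 * slopeLip κ b₀ ≤ A' * M ∧
      4 * H ≤ A' * M ∧ δ / 2 * Metric.diam T ^ 2 < μ₀ * M := by
    have e1 := Filter.eventually_ge_atTop (1 : ℝ)
    have e2 := (Filter.tendsto_id.const_mul_atTop hA'pos).eventually_ge_atTop (2 * slopeLip κ b₀)
    have e3 := (Filter.tendsto_id.const_mul_atTop hA'pos).eventually_ge_atTop (4 * H)
    have e4 := (Filter.tendsto_id.const_mul_atTop hμ₀).eventually_gt_atTop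
      (δ / 2 * Metric.diam T ^ 2)
    exact (e1.and (e2.and (e3.and e4))).exists
  have hM0 : 0 < M := one_pos.trans_le hM1
  refine ⟨δ, hδ, M, hM0, C₂, hC₂, hball, ?_⟩
  intro u hu hτ hus σ q C₀ Ct hC₀ hCt hlower hgrowth x₁ hx₁ x₂ hx₂ Y₁ hY₁ Y₂ hY₂ hne hle η hη hηδ
    hηC hηM
  have hx₁Ω : x₁ ∈ Ω := hball (Metric.ball_subset_ball (by linarith) hx₁)
  have hx₂Ω : x₂ ∈ Ω := hball (Metric.ball_subset_ball (by linarith) hx₂)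
  obtain ⟨t, ht, e, he, heτ, hφ₁, hφ₂⟩ := hC.exists_common_point hu hτ hx₁Ω hx₂Ω hY₁ hY₂
  have hx₁n := mem_ball_iff_norm.1 hx₁
  have hx₂n := mem_ball_iff_norm.1 hx₂
  have hx₁₂ : ‖x₁ - x₂‖ < δ := by
    have : x₁ - x₂ = (x₁ - Xs.fst) - (x₂ - Xs.fst) := by abel
    rw [this]
    exact (norm_sub_le _ _).trans_lt (by linarith)
  have hzball : x₁ + t • (x₂ - x₁) ∈ Metric.ball Xs.fst (δ / 2) := by
    have := convex_ball Xs.fst (δ / 2) hx₁ hx₂ (sub_nonneg.2 ht.2) ht.1 (sub_add_cancel 1 t)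
    rwa [show (1 - t) • x₁ + t • x₂ = x₁ + t • (x₂ - x₁) by module] at this
  set x₀ := x₁ + t • (x₂ - x₁) with hx₀
  have hzn := mem_ball_iff_norm.1 hzball
  have hx₀Ω : x₀ ∈ Ω := hball (Metric.ball_subset_ball (by linarith) hzball)
  have heXs : |e - Xs.snd| < 2 * ℓ * δ := by
    have h1 := hC.refractor_lipschitz hu hτ hx₁Ω hXs.1
    rw [hus] at h1
    have h2 : e - Xs.snd = (e - u x₁) + (u x₁ - Xs.snd) := by ring
    rw [h2]
    refine (abs_add_le _ _).trans_lt ?_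
    have h3 : ℓ * ‖x₁ - x₂‖ < ℓ * δ := by gcongr
    have h4 : ℓ * ‖x₁ - Xs.fst‖ < ℓ * (δ / 2) := by gcongr
    have h5 : 0 < ℓ * δ := by positivity
    linarith
  set Z : Space n := pt x₀ e with hZdef
  have hZC : Z ∈ sourceCylinder Ω τ₀ :=
    ⟨hx₀Ω, by rw [hZdef, pt_snd]; linarith [(abs_lt.1 heXs).1], heτ⟩
  have hZUV : Z ∈ U ∩ V := hεUV (by
    rw [mem_ball_iff_norm]
    refine (norm_le_fst_add_snd _).trans_lt ?_
    rw [WithLp.sub_fst, WithLp.sub_snd, hZdef, pt_fst, pt_snd]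
    linarith)
  set s := ‖Y₁ - Y₂‖ with hs
  have hs0 : 0 < s := norm_pos_iff.2 (sub_ne_zero.2 hne)
  set d := ‖x₁ - x₂‖ with hd
  set μ := η * s ^ 2 / M with hμ
  have hμpos : 0 < μ := by positivity
  have hμlt : μ < μ₀ := by
    rw [hμ, div_lt_iff₀ hM0]
    have h1 : s ≤ Metric.diam T := by
      rw [hs, ← dist_eq_norm]
      exact Metric.dist_le_diam_of_mem hC.target_compact.isBounded hY₁.1 hY₂.1
    calc η * s ^ 2 ≤ δ / 2 * Metric.diam T ^ 2 := by gcongr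
      _ < _ := hMμ
  have hs₁ : ∀ x ∈ Ω, phi κ x Y₁ Z ≤ u x := fun x hx => by rw [hφ₁]; exact hY₁.2 x hx
  have hs₂ : ∀ x ∈ Ω, phi κ x Y₂ Z ≤ u x := fun x hx => by rw [hφ₂]; exact hY₂.2 x hx
  have hcb : Metric.closedBall x₀ η ⊆ Ω := fun y hy => hball (by
    rw [Metric.mem_ball]
    rw [Metric.mem_closedBall] at hy
    rw [Metric.mem_ball] at hzball
    exact (dist_triangle y x₀ Xs.fst).trans_lt (by linarith))
  have hheight := hC.refractor_sub_le hu hτ hb₀ hb hZC hY₁.1 hY₂.1 hx₁Ω hx₂Ω ht rfl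
    (by rw [hφ₁, phi_at_base hκ]) (by rw [hφ₂, phi_at_base hκ]) hle
  have hsub := hC.thickening_subset hn hu hτ hb₀ hb hZC hY₁.1 hY₂.1 hne hA hC₂
    (fun x hx hxC Y hY => hregV Y₁ hY₁.1 Y₂ hY₂.1 Z ⟨hZUV.2, hZC⟩ x hx hxC Y hY) hs₁ hs₂ hη hηC hcb
    (μ := μ) (by
      rw [hμ, ← mul_div_assoc, div_le_iff₀ hM0]
      calc 2 * slopeLip κ b₀ * (η * s ^ 2) ≤ A' * M * (η * s ^ 2) := by gcongr
        _ = _ := by ring)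
    (by
      have h1 : 2 * ((κ + 1) ^ 2 / (κ ^ 2 - 1) * (u Z.fst - Z.snd)) ≤ 2 * (H * (s * d)) := by
        rw [hH, mul_assoc ((κ + 1) ^ 2 / (κ ^ 2 - 1))]
        gcongr
      have h2 : 4 * H * (s * d) ≤ A' * M ^ 2 * (s * d) := by
        have h0 : A' * M ≤ A' * M ^ 2 := by gcongr; exact le_self_pow₀ hM1 two_ne_zero
        exact mul_le_mul_of_nonneg_right (hMH.trans h0) (by positivity)
      have h3 : A' * M ^ 2 * (s * d) ≤ A' * s ^ 2 * η ^ 2 := by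
        calc _ = A' * s * (M ^ 2 * d) := by ring
          _ ≤ A' * s * (η ^ 2 * s) := by gcongr
          _ = _ := by ring
      have h4 : 0 < A' * s ^ 2 * η ^ 2 := by positivity
      change _ < A' * s ^ 2 * η ^ 2
      linarith)
  have hmeas := (hlower Y₁ hY₁.1 Y₂ hY₂.1 Z ⟨hZUV.1, hZC⟩ μ hμpos hμlt).trans
    ((measure_mono hsub).trans (hgrowth x₀ η hη hcb))
  exact (ENNReal.ofReal_le_ofReal_iff (by positivity)).1 hmeas

end Growth

/-! ### Algebra of the Hölder exponent. -/

section Exponent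

variable {n : ℕ}

lemma holderExponent_denominator_pos (hn : 1 ≤ n) {q : ℝ} (hq₁ : 1 ≤ q) :
    0 < 1 + 3 / 2 * ((n : ℝ) - 1) + (n : ℝ) / (2 * q) := by
  have h1 : (1 : ℝ) ≤ n := by exact_mod_cast hn
  have h2 : 0 ≤ (n : ℝ) / (2 * q) := by positivity
  linarith

lemma holderExponent_pos (hn : 1 ≤ n) {q : ℝ} (hq₁ : 1 ≤ q)
    (hq₂ : q * ((n : ℝ) - 1) < (n : ℝ)) : 0 < holderExponent n q := by
  refine div_pos ?_ (holderExponent_denominator_pos hn hq₁)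
  rw [sub_pos, div_lt_div_iff₀ two_pos (by linarith)]
  linarith

lemma holderExponent_lt_one (hn : 1 ≤ n) {q : ℝ} (hq₁ : 1 ≤ q) : holderExponent n q < 1 := by
  have h1 : (1 : ℝ) ≤ n := by exact_mod_cast hn
  rw [holderExponent, div_lt_one (holderExponent_denominator_pos hn hq₁)]
  linarith

/-- The Hölder constant. -/
noncomputable def holderConst (n : ℕ) (q C₀ Ct M : ℝ) : ℝ :=
  (C₀ / Ct * M ^ ((n : ℝ) / q)) ^ (1 + 3 / 2 * ((n : ℝ) - 1) + (n : ℝ) / (2 * q))⁻¹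

lemma holderConst_pos (q : ℝ) {C₀ Ct M : ℝ} (hC₀ : 0 < C₀) (hCt : 0 < Ct) (hM : 0 < M) :
    0 < holderConst n q C₀ Ct M := by
  unfold holderConst; positivity

/-- The growth inequality at the scale `η = M √(d / s)`, solved for `s`. -/
lemma le_holderConst_mul_rpow (hn : 1 ≤ n) {q C₀ Ct M s d : ℝ} (hq₁ : 1 ≤ q) (hC₀ : 0 < C₀)
    (hCt : 0 < Ct) (hM : 0 < M) (hs : 0 < s) (hd : 0 < d)
    (h : Ct * (M * Real.sqrt (d / s) * s ^ 2 / M) ^ (n - 1) * s ≤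
      C₀ * (M * Real.sqrt (d / s)) ^ ((n : ℝ) / q)) :
    s ≤ holderConst n q C₀ Ct M * d ^ holderExponent n q := by
  set a := (n : ℝ) / (2 * q) with ha
  set m := (n : ℝ) - 1 with hm
  have hE : 0 < 1 + 3 / 2 * m + a := holderExponent_denominator_pos hn hq₁
  have hnq : (n : ℝ) / q = 2 * a := by rw [ha]; field_simp
  set K := C₀ / Ct * M ^ ((n : ℝ) / q) with hK
  have hK0 : 0 < K := by positivity
  have hcast : ((n - 1 : ℕ) : ℝ) = m := by rw [Nat.cast_sub hn, Nat.cast_one]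
  -- At this scale μ = d^(1/2) s^(3/2), which explains the term 3/2 (n - 1) in the denominator of
  -- the exponent and the loss (n - 1)/2 in its numerator.
  have key : s ^ (1 + 3 / 2 * m + a) ≤ K * d ^ (a - m / 2) := by
    have e1 : M * Real.sqrt (d / s) * s ^ 2 / M = d ^ (1 / 2 : ℝ) * s ^ (3 / 2 : ℝ) := by
      rw [Real.sqrt_eq_rpow, Real.div_rpow hd.le hs.le]
      have : s ^ 2 = s ^ (3 / 2 : ℝ) * s ^ (1 / 2 : ℝ) := by
        rw [← Real.rpow_add hs, ← Real.rpow_two]; norm_num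
      rw [this]; field_simp
    have e2 : (M * Real.sqrt (d / s)) ^ ((n : ℝ) / q) =
        M ^ ((n : ℝ) / q) * (d ^ a / s ^ a) := by
      rw [Real.mul_rpow hM.le (Real.sqrt_nonneg _), Real.sqrt_eq_rpow, ← Real.rpow_mul (by positivity),
        hnq, show 1 / 2 * (2 * a) = a by ring, Real.div_rpow hd.le hs.le]
    rw [e1, e2, ← Real.rpow_natCast, hcast, Real.mul_rpow (by positivity) (by positivity),
      ← Real.rpow_mul hd.le, ← Real.rpow_mul hs.le] at h
    have e3 : s ^ (1 + 3 / 2 * m + a) = s ^ (3 / 2 * m) * s * s ^ a := by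
      rw [Real.rpow_add hs, add_comm, Real.rpow_add hs, Real.rpow_one]
    have e4 : d ^ (a - m / 2) = d ^ a / d ^ (1 / 2 * m) := by
      rw [Real.rpow_sub hd]; congr 2; ring
    rw [e3, e4, hK]
    have p1 : 0 < d ^ (1 / 2 * m) := by positivity
    have p2 : 0 < s ^ a := by positivity
    rw [← mul_div_assoc, le_div_iff₀ p1]
    have h' : Ct * (d ^ (1 / 2 * m) * s ^ (3 / 2 * m)) * s * s ^ a ≤
        C₀ * (M ^ ((n : ℝ) / q) * d ^ a) := by
      calc _ ≤ C₀ * (M ^ ((n : ℝ) / q) * (d ^ a / s ^ a)) * s ^ a := by gcongr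
        _ = _ := by field_simp
    refine le_of_mul_le_mul_left ?_ hCt
    calc _ = Ct * (d ^ (1 / 2 * m) * s ^ (3 / 2 * m)) * s * s ^ a := by ring
      _ ≤ C₀ * (M ^ ((n : ℝ) / q) * d ^ a) := h'
      _ = _ := by field_simp
  have h1 : s = (s ^ (1 + 3 / 2 * m + a)) ^ (1 + 3 / 2 * m + a)⁻¹ :=
    (Real.rpow_rpow_inv hs.le hE.ne').symm
  have h2 : (K * d ^ (a - m / 2)) ^ (1 + 3 / 2 * m + a)⁻¹ =
      holderConst n q C₀ Ct M * d ^ holderExponent n q := by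
    rw [Real.mul_rpow hK0.le (by positivity), ← Real.rpow_mul hd.le, ← div_eq_mul_inv]
    rfl
  rw [← h2, h1]
  exact Real.rpow_le_rpow (by positivity) key (by positivity)

/-- Turns Lipschitz bounds on a bounded set into Hölder bounds. -/
lemma le_rpow_mul_rpow {d R α : ℝ} (hd : 0 ≤ d) (hdR : d ≤ R) (hα₁ : α < 1) :
    d ≤ R ^ (1 - α) * d ^ α := by
  rcases hd.eq_or_lt with rfl | hd
  · have := Real.rpow_nonneg hdR (1 - α)
    exact mul_nonneg this (Real.rpow_nonneg le_rfl _)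
  · calc d = d ^ (1 - α) * d ^ α := by rw [← Real.rpow_add hd]; simp
      _ ≤ _ := by gcongr

end Exponent

/-! ### From Hölder foci to a Hölder gradient. -/

section HolderGradient

variable {n : ℕ} {κ τ₀ τ₁ ω : ℝ} {Ω : Set (Base n)} {T : Set (Space n)} {u : Base n → ℝ}

/-- The slopes of the supporting hyperboloids depend on the contact points in a Hölder
continuous way if their foci do. -/
lemma Configuration.exists_slope_holder (hC : Configuration κ Ω T τ₀ τ₁ ω)
    (hu : IsRefractor κ Ω T u) (hτ : ∀ x ∈ Ω, u x ≤ τ₀) {B : Set (Base n)} (hB : B ⊆ Ω)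
    {R α K : ℝ} (hR : ∀ x ∈ B, ∀ x' ∈ B, ‖x - x'‖ ≤ R) (hα₁ : α < 1)
    {Y : Base n → Space n} (hY : ∀ x ∈ B, Y x ∈ T)
    (hK : ∀ x ∈ B, ∀ x' ∈ B, ‖Y x - Y x'‖ ≤ K * ‖x - x'‖ ^ α) :
    ∃ L : ℝ, ∀ x ∈ B, ∀ x' ∈ B,
      ‖slopeTo κ (pt x (u x)) (Y x) - slopeTo κ (pt x' (u x')) (Y x')‖ ≤ L * ‖x - x'‖ ^ α := by
  have hκ := hC.one_lt_kappa
  have hk := kappa_sq_sub_one_pos hκ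
  have hb₀ := hC.lower_pos
  set b₀ := (κ - 1) ^ 2 / κ * (τ₁ - τ₀) with hb₀def
  set ℓ := (Real.sqrt (κ ^ 2 - 1))⁻¹ with hℓ
  have hℓ0 : 0 < ℓ := inv_pos.2 (Real.sqrt_pos.2 hk)
  refine ⟨b₀⁻¹ * (2 + ℓ) * ((1 + (κ + 1) * (1 + ℓ)) * R ^ (1 - α) + (κ + 2) * K), ?_⟩
  intro x hx x' hx'
  have hX := mem_sourceCylinder hu hτ (hB hx)
  have hX' := mem_sourceCylinder hu hτ (hB hx')
  refine (norm_hypSlope_sub_le hκ (Y x) (Y x') hb₀ (hC.cFun_lower hX (hY x hx))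
    (hC.cFun_lower hX' (hY x' hx')) _ _).trans ?_
  rw [mul_assoc (b₀⁻¹ * (2 + ℓ))]
  refine mul_le_mul_of_nonneg_left ?_ (by positivity)
  have h1 := space_norm_fst_le (Y x - Y x')
  rw [WithLp.sub_fst] at h1
  have h2 : ‖((Y x).fst - x) - ((Y x').fst - x')‖ ≤ ‖Y x - Y x'‖ + ‖x - x'‖ := by
    rw [show ((Y x).fst - x) - ((Y x').fst - x') = ((Y x).fst - (Y x').fst) - (x - x') by abel]
    exact (norm_sub_le _ _).trans (by gcongr)
  have h3 := abs_cFun_sub_le hκ (pt x (u x)) (pt x' (u x')) (Y x) (Y x')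
  have h4 : ‖(pt x (u x) : Space n) - pt x' (u x')‖ ≤ (1 + ℓ) * ‖x - x'‖ := by
    refine (norm_le_fst_add_snd _).trans ?_
    rw [WithLp.sub_fst, WithLp.sub_snd, pt_fst, pt_fst, pt_snd, pt_snd]
    linarith [hC.refractor_lipschitz hu hτ (hB hx) (hB hx')]
  have h5 : (κ + 1) * (‖(pt x (u x) : Space n) - pt x' (u x')‖ + ‖Y x - Y x'‖) ≤
      (κ + 1) * ((1 + ℓ) * ‖x - x'‖ + ‖Y x - Y x'‖) := by gcongr
  have h6 := le_rpow_mul_rpow (norm_nonneg (x - x')) (hR x hx x' hx') hα₁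
  have h7 := mul_le_mul_of_nonneg_left h6 (by positivity : 0 ≤ 1 + (κ + 1) * (1 + ℓ))
  have h8 := mul_le_mul_of_nonneg_left (hK x hx x' hx') (by positivity : 0 ≤ κ + 2)
  rw [pt_fst, pt_fst]
  linarith

/-- If the foci of the supporting hyperboloids are Hölder continuous, the refractor is
`C^{1,α}`. -/
lemma Configuration.isC1Holder (hC : Configuration κ Ω T τ₀ τ₁ ω)
    (hu : IsRefractor κ Ω T u) (hτ : ∀ x ∈ Ω, u x ≤ τ₀) {B : Set (Base n)} (hB : B ⊆ Ω)
    (hBo : IsOpen B) {R α K : ℝ} (hR : ∀ x ∈ B, ∀ x' ∈ B, ‖x - x'‖ ≤ R) (hα₀ : 0 < α)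
    (hα₁ : α < 1)
    (hK : ∀ x ∈ B, ∀ x' ∈ B, ∀ Y ∈ normalMap κ Ω T u x, ∀ Y' ∈ normalMap κ Ω T u x',
      ‖Y - Y'‖ ≤ K * ‖x - x'‖ ^ α) : IsC1Holder α u B := by
  classical
  have hκ := hC.one_lt_kappa
  have hex : ∀ x, ∃ Y, x ∈ B → Y ∈ normalMap κ Ω T u x := fun x => by
    by_cases hx : x ∈ B
    · obtain ⟨Y, hY⟩ := hu.normalMap_nonempty hκ (hB hx)
      exact ⟨Y, fun _ => hY⟩
    · exact ⟨0, fun h => absurd h hx⟩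
  choose Y hYmem using hex
  obtain ⟨L, hL⟩ := hC.exists_slope_holder hu hτ hB hR hα₁ (fun x hx => (hYmem x hx).1)
    fun x hx x' hx' => hK x hx x' hx' _ (hYmem x hx) _ (hYmem x' hx')
  have hb₀ := hC.lower_pos
  set b₀ := (κ - 1) ^ 2 / κ * (τ₁ - τ₀) with hb₀def
  set v : Base n → Base n := fun x => slopeTo κ (pt x (u x)) (Y x) with hv
  have hsupp : ∀ x ∈ B, ∀ x' ∈ B,
      u x + inner ℝ (v x) (x' - x) - (2 * b₀)⁻¹ * ‖x' - x‖ ^ 2 ≤ u x' := by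
    intro x hx x' hx'
    have hX := mem_sourceCylinder hu hτ (hB hx)
    have hY := (hYmem x hx).1
    have h1 := (tangent_sub_le_hyperboloid hκ (Y x) (hC.cFun_pos hX hY) x x').trans
      ((hYmem x hx).2 x' (hB hx'))
    have hbase : hyperboloid κ (Y x) (cFun κ (pt x (u x)) (Y x)) x = u x :=
      phi_at_base hκ (Y x) x (u x)
    rw [hbase] at h1
    have h2 : (2 * cFun κ (pt x (u x)) (Y x))⁻¹ * ‖x' - x‖ ^ 2 ≤ (2 * b₀)⁻¹ * ‖x' - x‖ ^ 2 := by
      gcongr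
      exact hC.cFun_lower hX hY
    have h3 : inner ℝ (v x) (x' - x) =
      inner ℝ (hypSlope κ (Y x) (cFun κ (pt x (u x)) (Y x)) x) (x' - x) := rfl
    linarith
  have hgrad : ∀ x ∈ B, HasGradientAt u (v x) x := by
    intro x hx
    refine hasGradientAt_of_abs_sub_le (K := L + (2 * b₀)⁻¹ * R ^ (1 - α)) (β := 1 + α)
      (by linarith) ?_
    filter_upwards [hBo.mem_nhds hx] with x' hx'
    -- The support at x gives the lower bound. The support at x' gives the upper bound, once its
    -- slope is replaced by the one at x at the cost of the Hölder estimate.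
    have h1 := hsupp x hx x' hx'
    have h2 := hsupp x' hx' x hx
    rw [← neg_sub x' x, inner_neg_right, norm_neg] at h2
    have h3 : inner ℝ (v x') (x' - x) - inner ℝ (v x) (x' - x) ≤
        L * ‖x' - x‖ ^ α * ‖x' - x‖ := by
      rw [← inner_sub_left]
      exact (real_inner_le_norm _ _).trans (by gcongr; exact hL x' hx' x hx)
    have h4 : ‖x' - x‖ ^ (1 + α) = ‖x' - x‖ ^ α * ‖x' - x‖ := by
      rw [add_comm, Real.rpow_add_one' (norm_nonneg _) (by linarith)]
    have h5 : (2 * b₀)⁻¹ * ‖x' - x‖ ^ 2 ≤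
        (2 * b₀)⁻¹ * (R ^ (1 - α) * ‖x' - x‖ ^ α * ‖x' - x‖) := by
      rw [sq]
      gcongr
      exact le_rpow_mul_rpow (norm_nonneg _) (hR x' hx' x hx) hα₁
    have h6 : 0 ≤ L * ‖x' - x‖ ^ α * ‖x' - x‖ :=
      mul_nonneg ((norm_nonneg _).trans (hL x' hx' x hx)) (norm_nonneg _)
    rw [h4, abs_le]
    constructor <;> nlinarith
  have hgrad_eq : ∀ x ∈ B, gradient u x = v x := fun x hx => (hgrad x hx).gradient
  have hhol : ∀ x ∈ B, ∀ y ∈ B, ‖gradient u x - gradient u y‖ ≤ L * ‖x - y‖ ^ α := by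
    intro x hx y hy
    rw [hgrad_eq x hx, hgrad_eq y hy]
    exact hL x hx y hy
  refine ⟨?_, L, hhol⟩
  have hcont : ContinuousOn (gradient u) B := by
    intro x hx
    rw [ContinuousWithinAt, tendsto_iff_norm_sub_tendsto_zero]
    have h0 : Filter.Tendsto (fun y => L * ‖y - x‖ ^ α) (𝓝[B] x) (𝓝 0) := by
      have hc : Continuous fun y : Base n => L * ‖y - x‖ ^ α :=
        continuous_const.mul ((continuous_id.sub continuous_const).norm.rpow_const
          fun _ => Or.inr hα₀.le)
      have := (hc.tendsto x).mono_left (nhdsWithin_le_nhds (s := B))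
      simpa [Real.zero_rpow hα₀.ne'] using this
    refine squeeze_zero' (Filter.Eventually.of_forall fun _ => norm_nonneg _) ?_ h0
    filter_upwards [self_mem_nhdsWithin] with y hy
    exact hhol y hy x hx
  have h1 : ContDiffOn ℝ (0 + 1) u B := by
    rw [contDiffOn_succ_iff_fderiv_of_isOpen hBo]
    refine ⟨fun x hx => (hgrad x hx).differentiableAt.differentiableWithinAt, by simp, ?_⟩
    rw [contDiffOn_zero, ← toDual_comp_gradient]
    exact (InnerProductSpace.toDual ℝ (Base n)).continuous.comp_continuousOn hcont
  simpa using h1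

end HolderGradient

/-! ### The main theorem: choice of scale and conclusion. -/

theorem mainTheorem1 (n : ℕ) (hn : 1 ≤ n) (q : ℝ) (hq₁ : 1 ≤ q)
    (hq₂ : q * ((n : ℝ) - 1) < (n : ℝ)) :
    0 < holderExponent n q ∧ holderExponent n q < 1 ∧
    ∃ C₁ : ℝ → ℝ → ℝ → ℝ,
      (∀ C₀ Ct M : ℝ, 0 < C₀ → 0 < Ct → 0 < M → 0 < C₁ C₀ Ct M) ∧
      ∀ (κ : ℝ) (Ω : Set (Base n)) (T : Set (Space n)) (τ₀ τ₁ ω : ℝ),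
        Configuration κ Ω T τ₀ τ₁ ω →
        ∀ Xs ∈ sourceCylinder Ω τ₀, RegularFrom κ Ω T τ₀ Xs →
        ∀ U ∈ 𝓝 Xs, ∀ μ₀ : ℝ, 0 < μ₀ →
        ∃ δ > 0, ∃ M > 0, ∃ C₂ > 0, Metric.ball Xs.fst δ ⊆ Ω ∧
          ∀ u : Base n → ℝ, IsRefractor κ Ω T u → (∀ x ∈ Ω, u x ≤ τ₀) → u Xs.fst = Xs.snd →
          ∀ σ : Measure (Space n), IsFiniteMeasure σ → σ Tᶜ = 0 →
          ∀ C₀ Ct : ℝ, 0 < C₀ → 0 < Ct →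
            LocalLowerBound κ Ω T τ₀ U μ₀ Ct σ → GrowthBound κ Ω T u q C₀ σ →
            (∀ x₁ ∈ Metric.ball Xs.fst (δ / 2), ∀ x₂ ∈ Metric.ball Xs.fst (δ / 2),
              ∀ Y₁ ∈ normalMap κ Ω T u x₁, ∀ Y₂ ∈ normalMap κ Ω T u x₂,
                max 1 (max ((2 * M / δ) ^ 2) ((2 * M / C₂) ^ 2)) * ‖x₁ - x₂‖ ≤ ‖Y₁ - Y₂‖ →
                ‖Y₁ - Y₂‖ ≤ C₁ C₀ Ct M * ‖x₁ - x₂‖ ^ holderExponent n q) ∧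
            IsC1Holder (holderExponent n q) u (Metric.ball Xs.fst (δ / 2)) := by
  have hα₀ := holderExponent_pos hn hq₁ hq₂
  have hα₁ := holderExponent_lt_one hn hq₁
  refine ⟨hα₀, hα₁, holderConst n q, fun C₀ Ct M => holderConst_pos q, ?_⟩
  intro κ Ω T τ₀ τ₁ ω hC Xs hXs hreg U hU μ₀ hμ₀
  -- At height zero no refractor passes through X*, since refractors are positive.
  rcases hXs.2.1.eq_or_lt with h0 | hpos
  · obtain ⟨δ, hδ, hball⟩ := Metric.isOpen_iff.1 hC.source_open Xs.fst hXs.1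
    refine ⟨δ, hδ, 1, one_pos, 1, one_pos, hball, ?_⟩
    intro u hu _ hus
    have := hu.1 Xs.fst hXs.1
    rw [hus, ← h0] at this
    exact absurd this (lt_irrefl 0)
  obtain ⟨δ, hδ, M, hM, C₂, hC₂, hball, hmain⟩ :=
    hC.exists_growth_inequality hn hXs hpos hreg hU hμ₀
  refine ⟨δ, hδ, M, hM, C₂, hC₂, hball, ?_⟩
  intro u hu hτ hus σ _ _ C₀ Ct hC₀ hCt hlower hgrowth
  set α := holderExponent n q with hα
  set C₁ := holderConst n q C₀ Ct M with hC₁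
  have hC₁0 : 0 < C₁ := holderConst_pos q hC₀ hCt hM
  set m := max 1 (max ((2 * M / δ) ^ 2) ((2 * M / C₂) ^ 2)) with hm
  have hm1 : 1 ≤ m := le_max_left _ _
  have hm0 : 0 < m := one_pos.trans_le hm1
  have hest : ∀ x₁ ∈ Metric.ball Xs.fst (δ / 2), ∀ x₂ ∈ Metric.ball Xs.fst (δ / 2),
      ∀ Y₁ ∈ normalMap κ Ω T u x₁, ∀ Y₂ ∈ normalMap κ Ω T u x₂,
        m * ‖x₁ - x₂‖ ≤ ‖Y₁ - Y₂‖ → ‖Y₁ - Y₂‖ ≤ C₁ * ‖x₁ - x₂‖ ^ α := by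
    intro x₁ hx₁ x₂ hx₂ Y₁ hY₁ Y₂ hY₂ hsep
    rcases eq_or_ne Y₁ Y₂ with rfl | hne
    · rw [sub_self, norm_zero]; positivity
    set s := ‖Y₁ - Y₂‖ with hs
    have hs0 : 0 < s := norm_pos_iff.2 (sub_ne_zero.2 hne)
    have hle : ‖x₁ - x₂‖ ≤ s := (le_mul_of_one_le_left (norm_nonneg _) hm1).trans hsep
    -- The distance |x₁ - x₂| is replaced by any larger d > 0, so that the scale η = M √(d/s) is
    -- positive even when the contact points coincide.
    have key : ∀ d : ℝ, 0 < d → ‖x₁ - x₂‖ ≤ d → m * d ≤ s → s ≤ C₁ * d ^ α := by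
      intro d hd hxd hds
      -- The separation constant m is made for this: m d ≤ s gives √(d/s) ≤ c/(2M), hence η ≤ δ/2
      -- and η ≤ C₂.
      have hscale : ∀ c : ℝ, 0 < c → (2 * M / c) ^ 2 ≤ m → M * Real.sqrt (d / s) ≤ c / 2 := by
        intro c hc hcm
        have h1 : (2 * M / c) ^ 2 * d ≤ s := le_trans (by gcongr) hds
        have h2 : Real.sqrt (d / s) ≤ c / (2 * M) := by
          refine Real.sqrt_le_iff.2 ⟨by positivity, ?_⟩
          rw [div_le_iff₀ hs0]
          calc d = (c / (2 * M)) ^ 2 * ((2 * M / c) ^ 2 * d) := by field_simp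
            _ ≤ _ := by gcongr
        calc _ ≤ M * (c / (2 * M)) := by gcongr
          _ = _ := by field_simp
      have hη₁ := hscale δ hδ ((le_max_left _ _).trans (le_max_right _ _))
      have hη₂ := hscale C₂ hC₂ ((le_max_right _ _).trans (le_max_right _ _))
      refine le_holderConst_mul_rpow hn hq₁ hC₀ hCt hM hs0 hd ?_
      refine hmain u hu hτ hus σ q C₀ Ct hC₀ hCt hlower hgrowth x₁ hx₁ x₂ hx₂ Y₁ hY₁ Y₂ hY₂ hne hle
        (M * Real.sqrt (d / s)) (by positivity) hη₁ (by linarith) ?_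
      rw [mul_pow, Real.sq_sqrt (by positivity), ← hs, mul_assoc, div_mul_cancel₀ _ hs0.ne']
      gcongr
    rcases (norm_nonneg (x₁ - x₂)).eq_or_lt with hd0 | hd0
    -- If x₁ = x₂, letting d tend to 0 forces s ≤ 0: the normal map is single-valued on the ball.
    · rw [← hd0, Real.zero_rpow hα₀.ne', mul_zero]
      have hc : Continuous fun d : ℝ => C₁ * d ^ α :=
        continuous_const.mul (Real.continuous_rpow_const hα₀.le)
      have ht := (hc.tendsto 0).mono_left (nhdsWithin_le_nhds (s := Ioi 0))
      rw [Real.zero_rpow hα₀.ne', mul_zero] at ht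
      refine ge_of_tendsto ht ?_
      filter_upwards [Ioc_mem_nhdsGT (div_pos hs0 hm0)] with d hd
      refine key d hd.1 (by rw [← hd0]; exact hd.1.le) ?_
      have := hd.2
      rw [le_div_iff₀ hm0] at this
      linarith
    · exact key _ hd0 le_rfl hsep
  refine ⟨hest, ?_⟩
  have hR : ∀ x ∈ Metric.ball Xs.fst (δ / 2), ∀ x' ∈ Metric.ball Xs.fst (δ / 2),
      ‖x - x'‖ ≤ δ := by
    intro x hx x' hx'
    rw [← dist_eq_norm]
    rw [Metric.mem_ball] at hx hx'
    exact (dist_triangle_right x x' Xs.fst).trans (by linarith)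
  refine hC.isC1Holder (K := C₁ + m * δ ^ (1 - α)) hu hτ
    ((Metric.ball_subset_ball (by linarith)).trans hball) Metric.isOpen_ball hR hα₀ hα₁ ?_
  intro x hx x' hx' Y hY Y' hY'
  have hp : 0 ≤ ‖x - x'‖ ^ α := by positivity
  -- Pairs violating the separation condition satisfy a Lipschitz bound, which is stronger than the
  -- Hölder one on a bounded ball.
  rcases le_total (m * ‖x - x'‖) ‖Y - Y'‖ with h | h
  · refine (hest x hx x' hx' Y hY Y' hY' h).trans ?_
    gcongr
    exact le_add_of_nonneg_right (by positivity)
  · refine h.trans ?_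
    have h1 := le_rpow_mul_rpow (norm_nonneg (x - x')) (hR x hx x' hx') hα₁
    calc m * ‖x - x'‖ ≤ m * (δ ^ (1 - α) * ‖x - x'‖ ^ α) := by gcongr
      _ = m * δ ^ (1 - α) * ‖x - x'‖ ^ α := by ring
      _ ≤ _ := by gcongr; exact le_add_of_nonneg_left hC₁0.le
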